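/- **Setting.** Let $\mathcal S$ be a measurable space, $P$ a probability measure on $\mathcal S$, $S\sim P$, $\mathcal X\subset\mathbb R^n$ a closed convex set, and $f:\mathbb R^n\times\mathcal S\to\mathbb R$ a function, measurable in its second argument, such that $f(x;\cdot)$ is $P$-integrable for every $x\in\mathcal X$. Let $\rho:\mathcal S\to\mathbb R$ be measurable and assume that $f(\cdot;s)$ is $\rho(s)$-weakly convex for each $s$, i.e. $x\mapsto f(x;s)+\frac{\rho(s)}2\|x\|_2^2$ is convex on $\mathbb R^n$. Put $F(x)=\mathbb E_P[f(x;S)]$ for $x\in\mathcal X$ and $\mathcal X^\star=\operatorname{argmin}_{x\in\mathcal X}F(x)$. Let $\partial f(x;s)$ be the Fréchet subdifferential of $f(\cdot;s)$ at $x$, and for $x\in\mathcal X$ let $\partial F(x)$ be the Fréchet subdifferential at $x$ of $F$ as a function on $\mathcal X$, i.e. the set of $v\in\mathbb R^n$ with $F(y)\ge F(x)+\langle v,y-x\rangle-o(\|y-x\|)$ as $y\to x$, $y\in\mathcal X$ (for $\mathcal X=\mathbb R^n$ this is the usual Fréchet subdifferential of $F$). **Assumptions.** 1. $\mathcal X^\star\neq\emptyset$,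 and there is $\sigma^2<\infty$ with $\mathbb E[\|f'(x^\star;S)\|_2^2]\le\sigma^2$ for every $x^\star\in\mathcal X^\star$ and every measurable selection $f'(x^\star;s)\in\partial f(x^\star;s)$. 2. There are $C_1,C_2<\infty$ such that for all $x\in\mathcal X$, all measurable selections $f'(x;s)\in\partial f(x;s)$ and all $F'(x)\in\partial F(x)$, the variance $\operatorname{Var}(f'(x;S))=\mathbb E\|f'(x;S)-\mathbb E f'(x;S)\|_2^2$ is finite and $\operatorname{Var}(f'(x;S))\le C_1\|F'(x)\|_2^2+C_2$. 3. $\inf_{x\in\mathcal X}F(x)>-\infty$ and $\mathbb E[\rho(S)^2]<\infty$. 4. $F$ is coercive: $F(x)\to\infty$ as $\|x\|\to\infty$, $x\in\mathcal X$. **Iteration.** Let $S_1,S_2,\dots$ be i.i.d. with law $P$, let $(\alpha_k)_{k\ge1}$ be positive stepsizes with $\sum_k\alpha_k^2<\infty$, let $x_1\in\mathbb R^n$ be a deterministic point, and let the iterates be generated with the proximal model, for $k=1,2,\dots$: $$x_{k+1}=\operatorname*{argmin}_{x\in\mathcal X}\Big\{f(x;S_k)+\frac{\rho(S_k)}2\|x-x_k\|_2^2+\frac1{2\alpha_k}\|x-x_k\|_2^2\Big\}.$$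 **Conclusion.** With probability one, $\sup_{k}\operatorname{dist}(x_k,\mathcal X^\star)<\infty$. -/

import Mathlib

open MeasureTheory ProbabilityTheory Filter Topology Set

/-- `φ` is `r`-weakly convex on `ℝⁿ`: `x ↦ φ x + (r / 2) ‖x‖²` is convex.
(The number `r` may be negative.) -/
def IsWeaklyConvex {n : ℕ} (r : ℝ) (φ : EuclideanSpace ℝ (Fin n) → ℝ) : Prop :=
  ConvexOn ℝ univ (fun x => φ x + r / 2 * ‖x‖ ^ 2)

/-- The Fréchet subdifferential at `x` of the function `φ` regarded as a function on the set `D`,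
i.e. of the extended-valued function equal to `φ` on `D` and to `+∞` off `D` (for `x ∈ D`): the
vectors `g` with `φ y ≥ φ x + ⟪g, y - x⟫ - o(‖y - x‖)` as `y → x` inside `D`. -/
def frechetSubdiffOn {n : ℕ} (D : Set (EuclideanSpace ℝ (Fin n)))
    (φ : EuclideanSpace ℝ (Fin n) → ℝ) (x : EuclideanSpace ℝ (Fin n)) :
    Set (EuclideanSpace ℝ (Fin n)) :=
  {g | ∀ ε : ℝ, 0 < ε → ∀ᶠ y in 𝓝[D] x, φ x + inner ℝ g (y - x) - ε * ‖y - x‖ ≤ φ y}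

/-- The population objective `F x = E_P[f(x; S)]`. -/
noncomputable def populationLoss {n : ℕ} {𝓢 : Type*} [MeasurableSpace 𝓢]
    (f : EuclideanSpace ℝ (Fin n) → 𝓢 → ℝ) (P : Measure 𝓢)
    (x : EuclideanSpace ℝ (Fin n)) : ℝ :=
  ∫ s, f x s ∂P

/-- The set `X* = argmin_{x ∈ X} F x`. -/
def optimalSet {n : ℕ} (X : Set (EuclideanSpace ℝ (Fin n)))
    (F : EuclideanSpace ℝ (Fin n) → ℝ) : Set (EuclideanSpace ℝ (Fin n)) :=
  {x | x ∈ X ∧ ∀ y ∈ X, F x ≤ F y}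

/-- `g` is a measurable selection `s ↦ f'(x; s) ∈ ∂f(x; s)`. -/
def IsSubgradSelection {n : ℕ} {𝓢 : Type*} [MeasurableSpace 𝓢]
    (f : EuclideanSpace ℝ (Fin n) → 𝓢 → ℝ) (x : EuclideanSpace ℝ (Fin n))
    (g : 𝓢 → EuclideanSpace ℝ (Fin n)) : Prop :=
  Measurable g ∧ ∀ s, g s ∈ frechetSubdiffOn univ (fun y => f y s) x

/-- The optimal set is non-empty, and the second moments of all subgradient selections at optimal
points are bounded by a common `σ² < ∞`. -/
def BoundedNoiseAtOptimum {n : ℕ} {𝓢 : Type*} [MeasurableSpace 𝓢]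
    (X : Set (EuclideanSpace ℝ (Fin n))) (f : EuclideanSpace ℝ (Fin n) → 𝓢 → ℝ)
    (P : Measure 𝓢) : Prop :=
  (optimalSet X (populationLoss f P)).Nonempty ∧
    ∃ σ : ℝ, ∀ x ∈ optimalSet X (populationLoss f P), ∀ g, IsSubgradSelection f x g →
      ∫⁻ s, ‖g s‖ₑ ^ 2 ∂P ≤ ENNReal.ofReal (σ ^ 2)

/-- Relative variance bound: there are constants with
`Var(f'(x; S)) = E ‖f'(x; S) - E f'(x; S)‖² ≤ C₁ ‖F'(x)‖² + C₂` (in particular, the left side is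
well defined and finite) for all `x ∈ X`, all measurable selections `f'(x; ·)` and all `F'(x)` in
the subdifferential of the constrained objective, i.e. of `F` as a function on `X`. -/
def RelativeVarianceBound {n : ℕ} {𝓢 : Type*} [MeasurableSpace 𝓢]
    (X : Set (EuclideanSpace ℝ (Fin n))) (f : EuclideanSpace ℝ (Fin n) → 𝓢 → ℝ)
    (P : Measure 𝓢) : Prop :=
  ∃ C₁ C₂ : ℝ, ∀ x ∈ X, ∀ g, IsSubgradSelection f x g →
    ∀ v ∈ frechetSubdiffOn X (populationLoss f P) x,
      MemLp g 2 P ∧ ∫ s, ‖g s - ∫ t, g t ∂P‖ ^ 2 ∂P ≤ C₁ * ‖v‖ ^ 2 + C₂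

/-- `F` is coercive on `X`: `F x → ∞` as `‖x‖ → ∞`, `x ∈ X`. -/
def IsCoerciveOn {n : ℕ} (X : Set (EuclideanSpace ℝ (Fin n)))
    (F : EuclideanSpace ℝ (Fin n) → ℝ) : Prop :=
  Tendsto F (Bornology.cobounded (EuclideanSpace ℝ (Fin n)) ⊓ 𝓟 X) atTop

/-- The (regularized) proximal model `f_x(y; s) = f(y; s) + (ρ(s) / 2) ‖y - x‖²`. -/
noncomputable def proxModel {n : ℕ} {𝓢 : Type*}
    (f : EuclideanSpace ℝ (Fin n) → 𝓢 → ℝ) (ρ : 𝓢 → ℝ)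
    (x y : EuclideanSpace ℝ (Fin n)) (s : 𝓢) : ℝ :=
  f y s + ρ s / 2 * ‖y - x‖ ^ 2

/-- `x⁺` is the model-based update
`argmin_{y ∈ X} { f_x(y; s) + (1 / (2α)) ‖y - x‖² }`, where `m x y s` is the model `f_x(y; s)`. -/
def IsModelUpdate {n : ℕ} {𝓢 : Type*} (X : Set (EuclideanSpace ℝ (Fin n)))
    (m : EuclideanSpace ℝ (Fin n) → EuclideanSpace ℝ (Fin n) → 𝓢 → ℝ)
    (α : ℝ) (s : 𝓢) (x xnext : EuclideanSpace ℝ (Fin n)) : Prop :=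
  xnext ∈ X ∧ ∀ y ∈ X,
    m x xnext s + 1 / (2 * α) * ‖xnext - x‖ ^ 2 ≤ m x y s + 1 / (2 * α) * ‖y - x‖ ^ 2

/-! The Lyapunov function is the Moreau envelope of `F` on `X` with a parameter `c > 0`, `c ≥ E ρ`:
let `V x` be `min_{y ∈ X} (F y + c/2 ‖y - x‖²) - inf_X F`, and let `z` be a proximal point of `x`.
Testing the envelope at `x'` with this fixed `z` gives `V x' ≤ F z - inf_X F + c/2 ‖x' - z‖²`, so it
suffices to bound `E ‖x' - z‖²` for one stochastic proximal step `x → x'`.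

Comparing the step with `z` and using a subgradient `g s` of `f(·; s)` at `z`, with mean `m`,
`IsModelUpdate.norm_sq_le` leaves two terms of order `α` and one of order `α²`. In mean the first is
`2α (E ρ - c) ‖x - z‖² ≤ 0`. The second is `2α ⟪c(x - z) - m, E x' - z⟫`, which is nonpositive for a
suitable `g`: `c(x - z)` is a Fréchet subgradient of `F` on `X` at `z`, and `g` can be chosen
measurably so as to attain the directional derivatives of `f(·; s)` in the single feasible direction
`E x' - z`. The term of order `α²` is controlled by `E ρ²` and by the variance bound at `z`, hence
by `V x + 1`.

Thus `E[V x' + 1] ≤ (1 + C α²)(V x + 1)`. As `∑ α²` is finite, a maximal inequality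
(`ae_bddAbove_of_lintegral_step_le`) bounds `V` along almost every path, and coercivity turns this
into a bound on the iterates. -/

/-! ### One-sided directional derivatives of convex and sublinear functions. -/

section DirectionalDerivative

variable {E : Type*} [NormedAddCommGroup E] [NormedSpace ℝ E]

/-- The one-sided directional derivative of `φ` at `w` in the direction `u`. -/
noncomputable def dirDeriv (φ : E → ℝ) (w u : E) : ℝ :=
  derivWithin (fun t : ℝ => φ (w + t • u)) (Ioi 0) 0

/-- Subadditive and positively homogeneous real functions. -/
structure IsSublinear (p : E → ℝ) : Prop where
  add_le : ∀ u v, p (u + v) ≤ p u + p v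
  smul : ∀ (c : ℝ) (u : E), 0 < c → p (c • u) = c * p u

theorem ConvexOn.comp_ray {φ : E → ℝ} (hφ : ConvexOn ℝ univ φ) (w u : E) :
    ConvexOn ℝ univ (fun t : ℝ => φ (w + t • u)) := by
  refine ⟨convex_univ, fun a _ b _ s t hs ht hst => ?_⟩
  have := hφ.2 (mem_univ (w + a • u)) (mem_univ (w + b • u)) hs ht hst
  convert this using 2
  have : w = (s + t) • w := by rw [hst, one_smul]
  conv_lhs => rw [this]
  simp only [smul_eq_mul]
  module

theorem ConvexOn.tendsto_dirDeriv {φ : E → ℝ} (hφ : ConvexOn ℝ univ φ) (w u : E) :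
    Tendsto (fun t : ℝ => t⁻¹ * (φ (w + t • u) - φ w)) (𝓝[>] 0) (𝓝 (dirDeriv φ w u)) := by
  have h := (hφ.comp_ray w u).hasDerivWithinAt_rightDeriv_of_mem_interior (x := 0) (by simp)
  rw [hasDerivWithinAt_iff_tendsto_slope' self_notMem_Ioi] at h
  refine h.congr fun t => ?_
  simp [slope_def_field, div_eq_inv_mul]

theorem ConvexOn.dirDeriv_le {φ : E → ℝ} (hφ : ConvexOn ℝ univ φ) (w u : E) :
    dirDeriv φ w u ≤ φ (w + u) - φ w := by
  have h := (hφ.comp_ray w u).le_slope_of_hasDerivWithinAt_Ioi (mem_univ 0) (mem_univ 1)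
    one_pos ((hφ.comp_ray w u).hasDerivWithinAt_rightDeriv_of_mem_interior (x := 0) (by simp))
  simpa [slope_def_field, dirDeriv] using h

/-- A sequential limit is what measurability and dominated convergence need. -/
theorem ConvexOn.tendsto_dirDeriv_seq {φ : E → ℝ} (hφ : ConvexOn ℝ univ φ) (w u : E) :
    Tendsto (fun k : ℕ => ((k : ℝ) + 1) * (φ (w + ((k : ℝ) + 1)⁻¹ • u) - φ w)) atTop
      (𝓝 (dirDeriv φ w u)) := by
  have h : Tendsto (fun k : ℕ => ((k : ℝ) + 1)⁻¹) atTop (𝓝[>] 0) :=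
    tendsto_inv_atTop_nhdsGT_zero.comp
      (tendsto_atTop_add_const_right _ _ tendsto_natCast_atTop_atTop)
  refine ((hφ.tendsto_dirDeriv w u).comp h).congr fun k => ?_
  simp

theorem ConvexOn.isSublinear_dirDeriv {φ : E → ℝ} (hφ : ConvexOn ℝ univ φ) (w : E) :
    IsSublinear (dirDeriv φ w) := by
  have hscale : ∀ c : ℝ, 0 < c → Tendsto (fun t : ℝ => c * t) (𝓝[>] 0) (𝓝[>] 0) := by
    intro c hc
    refine tendsto_nhdsWithin_iff.2 ⟨?_, ?_⟩
    · exact ((continuous_const_mul c).tendsto' 0 0 (by simp)).mono_left nhdsWithin_le_nhds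
    · filter_upwards [self_mem_nhdsWithin] with t ht using mul_pos hc ht
  refine ⟨fun u v => ?_, fun c u hc => ?_⟩
  · have h2 := hscale 2 two_pos
    refine le_of_tendsto_of_tendsto (hφ.tendsto_dirDeriv w (u + v))
      (((hφ.tendsto_dirDeriv w u).comp h2).add ((hφ.tendsto_dirDeriv w v).comp h2)) ?_
    filter_upwards [self_mem_nhdsWithin] with t (ht : 0 < t)
    have h := hφ.2 (mem_univ (w + (2 * t) • u)) (mem_univ (w + (2 * t) • v))
      (by norm_num : (0 : ℝ) ≤ 1 / 2) (by norm_num : (0 : ℝ) ≤ 1 / 2) (by norm_num)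
    have e : (1 / 2 : ℝ) • (w + (2 * t) • u) + (1 / 2 : ℝ) • (w + (2 * t) • v) =
        w + t • (u + v) := by module
    rw [e] at h
    simp only [smul_eq_mul] at h
    simp only [Function.comp]
    rw [mul_inv, ← sub_nonneg]
    have : 2⁻¹ * t⁻¹ * (φ (w + (2 * t) • u) - φ w) + 2⁻¹ * t⁻¹ * (φ (w + (2 * t) • v) - φ w)
        - t⁻¹ * (φ (w + t • (u + v)) - φ w) = t⁻¹ * (1 / 2 * φ (w + (2 * t) • u) +
          1 / 2 * φ (w + (2 * t) • v) - φ (w + t • (u + v))) := by ring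
    rw [this]
    exact mul_nonneg (inv_nonneg.2 ht.le) (by linarith)
  · refine tendsto_nhds_unique (hφ.tendsto_dirDeriv w (c • u))
      ((((hφ.tendsto_dirDeriv w u).comp (hscale c hc)).const_mul c).congr fun t => ?_)
    simp only [Function.comp, smul_smul, mul_inv, mul_comm t c]
    field_simp

theorem IsSublinear.convexOn {p : E → ℝ} (hp : IsSublinear p) : ConvexOn ℝ univ p := by
  refine convexOn_iff_forall_pos.2 ⟨convex_univ, fun u _ v _ a b ha hb _ => ?_⟩
  have h := hp.add_le (a • u) (b • v)
  rwa [hp.smul a u ha, hp.smul b v hb] at h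

theorem IsSublinear.map_zero {p : E → ℝ} (hp : IsSublinear p) : p 0 = 0 := by
  have := hp.smul 2 0 two_pos
  rw [smul_zero] at this
  linarith

theorem IsSublinear.neg_le {p : E → ℝ} (hp : IsSublinear p) (u : E) : -p (-u) ≤ p u := by
  have := hp.add_le u (-u)
  rw [add_neg_cancel, hp.map_zero] at this
  linarith

theorem IsSublinear.dirDeriv_le_self {p : E → ℝ} (hp : IsSublinear p) (w u : E) :
    dirDeriv p w u ≤ p u := by
  have := hp.convexOn.dirDeriv_le w u
  linarith [hp.add_le w u]

/-- The derivative lies below `p` at both `v` and `-v`, where the values of `p` sum to zero, while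
its own values there have a nonnegative sum; so equality holds. Directions already made linear
therefore survive further differentiation. -/
theorem IsSublinear.dirDeriv_eq_of_linear {p : E → ℝ} (hp : IsSublinear p) (w : E) {v : E}
    (hv : p (-v) = -p v) :
    dirDeriv p w v = p v ∧ dirDeriv p w (-v) = -dirDeriv p w v := by
  have h1 := hp.dirDeriv_le_self w v
  have h2 := hp.dirDeriv_le_self w (-v)
  have h3 := (hp.convexOn.isSublinear_dirDeriv w).neg_le v
  constructor <;> linarith

/-- Homogeneity makes `p` linear on the ray through `w`: `p (w - t w) = (1 - t) p w`.
Differentiating at `w` thus creates linearity along `w`. -/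
theorem IsSublinear.dirDeriv_self {p : E → ℝ} (hp : IsSublinear p) (w : E) :
    dirDeriv p w w = p w ∧ dirDeriv p w (-w) = -dirDeriv p w w := by
  have h1 := hp.dirDeriv_le_self w w
  have h2 := (hp.convexOn.isSublinear_dirDeriv w).neg_le w
  have h3 : dirDeriv p w (-w) ≤ -p w := by
    refine le_of_tendsto (hp.convexOn.tendsto_dirDeriv w (-w)) ?_
    have : ∀ᶠ t : ℝ in 𝓝[>] 0, t < 1 :=
      (eventually_lt_nhds one_pos).filter_mono nhdsWithin_le_nhds
    filter_upwards [self_mem_nhdsWithin, this] with t (ht : 0 < t) ht1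
    have e : w + t • -w = (1 - t) • w := by module
    rw [e, hp.smul _ _ (by linarith)]
    apply le_of_eq
    field_simp
    ring
  constructor <;> linarith

end DirectionalDerivative

/-! ### Measurable subgradients by repeated directional differentiation. -/

section MeasurableSubgradient

variable {𝓢 : Type*} [MeasurableSpace 𝓢]

theorem measurable_dirDeriv {E : Type*} [NormedAddCommGroup E] [NormedSpace ℝ E]
    {φ : E → 𝓢 → ℝ} (hm : ∀ u, Measurable (φ u))
    (hc : ∀ s, ConvexOn ℝ univ (fun u => φ u s)) (w u : E) :
    Measurable (fun s => dirDeriv (fun y => φ y s) w u) :=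
  measurable_of_tendsto_metrizable
    (f := fun (k : ℕ) s => ((k : ℝ) + 1) * (φ (w + ((k : ℝ) + 1)⁻¹ • u) s - φ w s))
    (fun _ => ((hm _).sub (hm _)).const_mul _)
    (tendsto_pi_nhds.2 fun s => (hc s).tendsto_dirDeriv_seq w u)

/-- A measurable family of sublinear functions dominates a measurable family that is moreover
linear along each vector of a given list, without changing where it was already linear. -/
theorem exists_measurable_sublinear_linear_on {E : Type*} [NormedAddCommGroup E] [NormedSpace ℝ E]
    (l : List E) :
    ∀ p : E → 𝓢 → ℝ, (∀ u, Measurable (p u)) → (∀ s, IsSublinear (fun u => p u s)) →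
      ∃ q : E → 𝓢 → ℝ, (∀ u, Measurable (q u)) ∧ (∀ s, IsSublinear (fun u => q u s)) ∧
        (∀ u s, q u s ≤ p u s) ∧ (∀ u s, p (-u) s = -p u s → q u s = p u s ∧ q (-u) s = -q u s) ∧
        ∀ v ∈ l, ∀ s, q (-v) s = -q v s := by
  induction l with
  | nil => exact fun p hm hs => ⟨p, hm, hs, fun _ _ => le_rfl, fun u s h => ⟨rfl, h⟩, by simp⟩
  | cons w l ih =>
    intro p hm hs
    -- Differentiating at `w` gives linearity along `w`, and the remaining differentiations preserve
    -- it.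
    obtain ⟨q, qm, qs, qle, qlin, ql⟩ := ih (fun u s => dirDeriv (fun y => p y s) w u)
      (measurable_dirDeriv hm (fun s => (hs s).convexOn) w)
      (fun s => (hs s).convexOn.isSublinear_dirDeriv w)
    refine ⟨q, qm, qs, fun u s => (qle u s).trans ((hs s).dirDeriv_le_self w u), ?_, ?_⟩
    · intro u s hu
      obtain ⟨h1, h2⟩ := (hs s).dirDeriv_eq_of_linear w hu
      obtain ⟨h3, h4⟩ := qlin u s h2
      exact ⟨h3.trans h1, h4⟩
    · intro v hv s
      rcases List.mem_cons.1 hv with rfl | hv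
      · exact (qlin v s ((hs s).dirDeriv_self v).2).2
      · exact ql v hv s

variable {n : ℕ}

/-- Subadditivity over the basis expansion gives `≤` for every vector; applying it to `-u` gives the
converse. -/
theorem IsSublinear.eq_inner_of_linear_on_basis {p : EuclideanSpace ℝ (Fin n) → ℝ}
    (hp : IsSublinear p)
    (hb : ∀ i, p (-EuclideanSpace.single i 1) = -p (EuclideanSpace.single i 1))
    (u : EuclideanSpace ℝ (Fin n)) :
    p u = inner ℝ (WithLp.toLp 2 fun i => p (EuclideanSpace.single i 1)) u := by
  have hsum : ∀ (s : Finset (Fin n)) (v : Fin n → EuclideanSpace ℝ (Fin n)),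
      p (∑ i ∈ s, v i) ≤ ∑ i ∈ s, p (v i) := by
    intro s v
    induction s using Finset.cons_induction with
    | empty => simp [hp.map_zero]
    | cons i s hi ih =>
      rw [Finset.sum_cons, Finset.sum_cons]
      exact (hp.add_le _ _).trans (by linarith)
  have hsc : ∀ (c : ℝ) i, p (c • EuclideanSpace.single i 1) =
      c * p (EuclideanSpace.single i 1) := by
    intro c i
    rcases lt_trichotomy c 0 with hc | rfl | hc
    · have h : c • (EuclideanSpace.single i 1 : EuclideanSpace ℝ (Fin n)) =
        (-c) • -EuclideanSpace.single i 1 := by module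
      rw [h, hp.smul _ _ (by linarith), hb]
      ring
    · simp [hp.map_zero]
    · exact hp.smul _ _ hc
  have hle : ∀ u : EuclideanSpace ℝ (Fin n),
      p u ≤ inner ℝ (WithLp.toLp 2 fun i => p (EuclideanSpace.single i 1)) u := by
    intro u
    have hu : u = ∑ i, u i • (EuclideanSpace.single i 1 : EuclideanSpace ℝ (Fin n)) := by
      ext j
      simp [Finset.sum_apply, Pi.single_apply]
    calc p u = p (∑ i, u i • (EuclideanSpace.single i 1 : EuclideanSpace ℝ (Fin n))) := by
          rw [← hu]
      _ ≤ ∑ i, p (u i • (EuclideanSpace.single i 1 : EuclideanSpace ℝ (Fin n))) := hsum _ _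
      _ = _ := by simp [hsc, PiLp.inner_apply]
  refine le_antisymm (hle u) ?_
  have h1 := hle (-u)
  rw [inner_neg_right] at h1
  linarith [hp.neg_le u]

/-- A measurable choice of subgradients of a measurable family of convex functions, attaining the
directional derivative in a prescribed direction. -/
theorem exists_measurable_subgradient {ψ : EuclideanSpace ℝ (Fin n) → 𝓢 → ℝ}
    (hm : ∀ u, Measurable (ψ u)) (hc : ∀ s, ConvexOn ℝ univ (fun u => ψ u s))
    (x₀ d : EuclideanSpace ℝ (Fin n)) :
    ∃ g : 𝓢 → EuclideanSpace ℝ (Fin n), Measurable g ∧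
      (∀ s y, ψ x₀ s + inner ℝ (g s) (y - x₀) ≤ ψ y s) ∧
      ∀ s, inner ℝ (g s) d = dirDeriv (fun u => ψ u s) x₀ d := by
  let p₀ : EuclideanSpace ℝ (Fin n) → 𝓢 → ℝ := fun u s => dirDeriv (fun y => ψ y s) x₀ u
  -- The direction `d` is treated before the basis vectors, so the value at `d` is frozen at the
  -- directional derivative of `ψ`.
  let p₁ : EuclideanSpace ℝ (Fin n) → 𝓢 → ℝ := fun u s => dirDeriv (fun y => p₀ y s) d u
  have hp₀m : ∀ u, Measurable (p₀ u) := measurable_dirDeriv hm hc x₀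
  have hp₀ : ∀ s, IsSublinear (fun u => p₀ u s) := fun s => (hc s).isSublinear_dirDeriv x₀
  obtain ⟨q, qm, qs, qle, qlin, ql⟩ := exists_measurable_sublinear_linear_on
    (List.ofFn fun i : Fin n => (EuclideanSpace.single i 1 : EuclideanSpace ℝ (Fin n))) p₁
    (measurable_dirDeriv hp₀m (fun s => (hp₀ s).convexOn) d)
    (fun s => (hp₀ s).convexOn.isSublinear_dirDeriv d)
  let g : 𝓢 → EuclideanSpace ℝ (Fin n) := fun s =>
    WithLp.toLp 2 fun i => q (EuclideanSpace.single i 1) s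
  have hg : ∀ s u, inner ℝ (g s) u = q u s := fun s u =>
    ((qs s).eq_inner_of_linear_on_basis (fun i => ql _ (by simp) s) u).symm
  refine ⟨g, ?_, fun s y => ?_, fun s => ?_⟩
  · exact (WithLp.measurable_toLp 2 _).comp (measurable_pi_lambda _ fun i => qm _)
  · rw [hg]
    have h1 := qle (y - x₀) s
    have h2 : p₁ (y - x₀) s ≤ p₀ (y - x₀) s := (hp₀ s).dirDeriv_le_self d (y - x₀)
    have h3 : p₀ (y - x₀) s ≤ ψ (x₀ + (y - x₀)) s - ψ x₀ s := (hc s).dirDeriv_le x₀ (y - x₀)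
    rw [add_sub_cancel] at h3
    linarith
  · rw [hg, (qlin d s ((hp₀ s).dirDeriv_self d).2).1]
    exact ((hp₀ s).dirDeriv_self d).1

end MeasurableSubgradient

/-! ### Quadratic growth at minimizers and its consequence for measurability. -/

section StronglyConvexMinimizers

theorem norm_sq_convex_combination {E : Type*} [NormedAddCommGroup E] [InnerProductSpace ℝ E]
    (x y z : E) (t : ℝ) :
    ‖z + t • (y - z) - x‖ ^ 2 =
      (1 - t) * ‖z - x‖ ^ 2 + t * ‖y - x‖ ^ 2 - t * (1 - t) * ‖y - z‖ ^ 2 := by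
  have e1 : z + t • (y - z) - x = (z - x) + t • (y - z) := by abel
  have e2 : y - x = (z - x) + (y - z) := by abel
  rw [e1, e2, norm_add_sq_real, norm_add_sq_real, norm_smul, inner_smul_right, mul_pow,
    Real.norm_eq_abs, sq_abs]
  ring

theorem norm_sub_sq_expand {E : Type*} [NormedAddCommGroup E] [InnerProductSpace ℝ E] (x y z : E) :
    ‖y - x‖ ^ 2 = ‖y - z‖ ^ 2 + ‖z - x‖ ^ 2 - 2 * inner ℝ (x - z) (y - z) := by
  have e : y - x = (y - z) - (x - z) := by abel
  rw [e, norm_sub_sq_real, norm_sub_rev z x, real_inner_comm]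
  ring

/-- Quadratic growth of `G + c ‖· - x‖²`, with `G` convex, away from its minimizer. -/
theorem ConvexOn.sq_growth_of_isMin {E : Type*} [NormedAddCommGroup E] [InnerProductSpace ℝ E]
    {X : Set E} {G : E → ℝ} (hG : ConvexOn ℝ X G) {c : ℝ} {x z : E} (hz : z ∈ X)
    (hmin : ∀ y ∈ X, G z + c * ‖z - x‖ ^ 2 ≤ G y + c * ‖y - x‖ ^ 2) {y : E} (hy : y ∈ X) :
    G z + c * ‖z - x‖ ^ 2 + c * ‖y - z‖ ^ 2 ≤ G y + c * ‖y - x‖ ^ 2 := by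
  -- Compare `z` with the point `z + t (y - z)`, divide by `t`, then let `t → 0`. The quadratic
  -- identity is exact, so the sign of `c` plays no role.
  have key : ∀ t ∈ Ioo (0 : ℝ) 1,
      c * (1 - t) * ‖y - z‖ ^ 2 ≤ G y + c * ‖y - x‖ ^ 2 - (G z + c * ‖z - x‖ ^ 2) := by
    rintro t ⟨ht0, ht1⟩
    have e : z + t • (y - z) = (1 - t) • z + t • y := by module
    have hmem : z + t • (y - z) ∈ X := by
      rw [e]
      exact hG.1 hz hy (by linarith) ht0.le (by ring)
    have h1 := hmin _ hmem
    have h2 := hG.2 hz hy (by linarith : (0 : ℝ) ≤ 1 - t) ht0.le (by ring)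
    rw [norm_sq_convex_combination, e] at h1
    simp only [smul_eq_mul] at h2
    have h3 : t * (c * (1 - t) * ‖y - z‖ ^ 2) ≤
        t * (G y + c * ‖y - x‖ ^ 2 - (G z + c * ‖z - x‖ ^ 2)) := by
      linarith
    exact le_of_mul_le_mul_left h3 ht0
  have hlim : Tendsto (fun t : ℝ => c * (1 - t) * ‖y - z‖ ^ 2) (𝓝[>] 0)
      (𝓝 (c * (1 - 0) * ‖y - z‖ ^ 2)) :=
    Tendsto.mono_left (Continuous.tendsto (by fun_prop) 0) nhdsWithin_le_nhds
  have := le_of_tendsto hlim (by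
    filter_upwards [Ioo_mem_nhdsGT (one_pos : (0 : ℝ) < 1)] with t ht using key t ht)
  linarith

/-- Minimizers with quadratic growth of a Carathéodory function depend measurably on the
parameter. -/
theorem measurable_of_sq_growth {E T : Type*} [NormedAddCommGroup E]
    [SecondCountableTopology E] [MeasurableSpace E] [BorelSpace E] [MeasurableSpace T]
    {X : Set E} {J : T → E → ℝ} {c : ℝ} (hc : 0 < c) {z : T → E}
    (hJm : ∀ y ∈ X, Measurable fun t => J t y) (hJc : ∀ t, Continuous (J t))
    (hzX : ∀ t, z t ∈ X) (hz : ∀ t, ∀ y ∈ X, J t (z t) + c * ‖y - z t‖ ^ 2 ≤ J t y) :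
    Measurable z := by
  classical
  rcases isEmpty_or_nonempty T with hT | ⟨⟨t₀⟩⟩
  · exact measurable_of_empty z
  have : Nonempty X := ⟨⟨z t₀, hzX t₀⟩⟩
  let d : ℕ → X := TopologicalSpace.denseSeq X
  have happ : ∀ t ε, 0 < ε → ∃ j, J t (d j) < J t (z t) + ε := by
    intro t ε hε
    have ho : IsOpen {y : X | J t y < J t (z t) + ε} :=
      isOpen_lt ((hJc t).comp continuous_subtype_val) continuous_const
    exact (TopologicalSpace.denseRange_denseSeq X).exists_mem_open ho
      ⟨⟨z t, hzX t⟩, by simpa using hε⟩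
  have hle : ∀ t j, J t (z t) ≤ J t (d j) := fun t j => by
    have := hz t (d j) (d j).2
    nlinarith [sq_nonneg ‖(d j : E) - z t‖]
  have hmin : (fun t => J t (z t)) = fun t => ⨅ j, J t (d j) := by
    funext t
    refine le_antisymm (le_ciInf (hle t)) (le_of_forall_pos_le_add fun ε hε => ?_)
    obtain ⟨j, hj⟩ := happ t ε hε
    exact (ciInf_le ⟨J t (z t), forall_mem_range.2 (hle t)⟩ j).trans hj.le
  have hmm : Measurable fun t => J t (z t) := by
    rw [hmin]
    exact Measurable.iInf fun j => hJm _ (d j).2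
  have hex : ∀ (k : ℕ) t, ∃ j, J t (d j) < J t (z t) + 1 / ((k : ℝ) + 1) := fun k t =>
    happ t _ (by positivity)
  -- The approximants are the first `1/(k+1)`-minimizers in a dense sequence of `X`; quadratic
  -- growth forces them to converge to `z t`.
  refine measurable_of_tendsto_metrizable (f := fun k t => (d (Nat.find (hex k t)) : E))
    (fun k => ?_) (tendsto_pi_nhds.2 fun t => ?_)
  · have hN : Measurable fun t => Nat.find (hex k t) := by
      refine measurable_find (hex k) fun j => ?_
      exact measurableSet_lt (hJm _ (d j).2) (hmm.add_const _)
    exact (measurable_from_nat (f := fun j => (d j : E))).comp hN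
  · rw [tendsto_iff_norm_sub_tendsto_zero]
    have hsq : Tendsto (fun k : ℕ => ‖(d (Nat.find (hex k t)) : E) - z t‖ ^ 2) atTop (𝓝 0) := by
      have h0 : Tendsto (fun k : ℕ => c⁻¹ * (1 / ((k : ℝ) + 1))) atTop (𝓝 0) := by
        simpa using (tendsto_one_div_add_atTop_nhds_zero_nat (𝕜 := ℝ)).const_mul c⁻¹
      refine squeeze_zero (fun _ => by positivity) (fun k => ?_) h0
      have h1 := Nat.find_spec (hex k t)
      have h2 := hz t _ (d (Nat.find (hex k t))).2
      rw [inv_mul_eq_div, le_div_iff₀ hc]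
      linarith
    have := hsq.sqrt
    simpa [Real.sqrt_sq (norm_nonneg _)] using this

end StronglyConvexMinimizers

/-! ### Weakly convex functions and the proximal update: existence, uniqueness, measurability. -/

section WeaklyConvex

variable {n : ℕ} {𝓢 : Type*}

/-- Moving the centre of the quadratic changes it only by an affine function. -/
theorem IsWeaklyConvex.convexOn_add_sq {r : ℝ} {φ : EuclideanSpace ℝ (Fin n) → ℝ}
    (h : IsWeaklyConvex r φ) (x : EuclideanSpace ℝ (Fin n)) :
    ConvexOn ℝ univ (fun y => φ y + r / 2 * ‖y - x‖ ^ 2) := by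
  refine ⟨convex_univ, fun u _ v _ a b ha hb hab => ?_⟩
  have h1 := h.2 (mem_univ u) (mem_univ v) ha hb hab
  obtain rfl : a = 1 - b := by linarith
  have e : (1 - b) • u + b • v = u + b • (v - u) := by module
  have h2 := norm_sq_convex_combination 0 v u b
  have h3 := norm_sq_convex_combination x v u b
  simp only [sub_zero] at h2
  simp only [smul_eq_mul, e] at h1 ⊢
  rw [h2] at h1
  rw [h3]
  linarith

theorem IsWeaklyConvex.continuous {r : ℝ} {φ : EuclideanSpace ℝ (Fin n) → ℝ}
    (h : IsWeaklyConvex r φ) : Continuous φ := by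
  have h1 : Continuous (fun y => φ y + r / 2 * ‖y‖ ^ 2) :=
    continuousOn_univ.1 (ConvexOn.continuousOn isOpen_univ h)
  have h2 : Continuous (fun y : EuclideanSpace ℝ (Fin n) => r / 2 * ‖y‖ ^ 2) := by fun_prop
  exact (h1.sub h2).congr fun y => by simp

theorem mem_frechetSubdiffOn_of_forall_le {D : Set (EuclideanSpace ℝ (Fin n))}
    {φ : EuclideanSpace ℝ (Fin n) → ℝ} {x g : EuclideanSpace ℝ (Fin n)} {r : ℝ}
    (h : ∀ y ∈ D, φ x + inner ℝ g (y - x) - r / 2 * ‖y - x‖ ^ 2 ≤ φ y) :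
    g ∈ frechetSubdiffOn D φ x := by
  intro ε hε
  have hlim : Tendsto (fun y => r / 2 * ‖y - x‖) (𝓝[D] x) (𝓝 (r / 2 * ‖x - x‖)) :=
    Tendsto.mono_left (Continuous.tendsto (by fun_prop) x) nhdsWithin_le_nhds
  rw [sub_self, norm_zero, mul_zero] at hlim
  filter_upwards [self_mem_nhdsWithin, hlim.eventually (ge_mem_nhds hε)] with y hy hyε
  have := mul_le_mul_of_nonneg_right hyε (norm_nonneg (y - x))
  linarith [h y hy]

theorem IsModelUpdate.sq_growth {X : Set (EuclideanSpace ℝ (Fin n))} (hXconvex : Convex ℝ X)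
    {f : EuclideanSpace ℝ (Fin n) → 𝓢 → ℝ} {ρ : 𝓢 → ℝ}
    (hweak : ∀ s, IsWeaklyConvex (ρ s) (fun x => f x s)) {α : ℝ} {s : 𝓢}
    {x z : EuclideanSpace ℝ (Fin n)} (h : IsModelUpdate X (proxModel f ρ) α s x z)
    {y : EuclideanSpace ℝ (Fin n)} (hy : y ∈ X) :
    proxModel f ρ x z s + 1 / (2 * α) * ‖z - x‖ ^ 2 + 1 / (2 * α) * ‖y - z‖ ^ 2 ≤
      proxModel f ρ x y s + 1 / (2 * α) * ‖y - x‖ ^ 2 :=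
  (((hweak s).convexOn_add_sq x).subset (subset_univ X) hXconvex).sq_growth_of_isMin h.1 h.2 hy

theorem IsModelUpdate.unique {X : Set (EuclideanSpace ℝ (Fin n))} (hXconvex : Convex ℝ X)
    {f : EuclideanSpace ℝ (Fin n) → 𝓢 → ℝ} {ρ : 𝓢 → ℝ}
    (hweak : ∀ s, IsWeaklyConvex (ρ s) (fun x => f x s)) {α : ℝ} (hα : 0 < α) {s : 𝓢}
    {x y z : EuclideanSpace ℝ (Fin n)} (hy : IsModelUpdate X (proxModel f ρ) α s x y)
    (hz : IsModelUpdate X (proxModel f ρ) α s x z) : y = z := by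
  have h1 := hz.sq_growth hXconvex hweak hy.1
  have h2 := hy.2 z hz.1
  have h3 : 1 / (2 * α) * ‖y - z‖ ^ 2 ≤ 0 := by linarith
  have h4 : ‖y - z‖ ^ 2 ≤ 0 := nonpos_of_mul_nonpos_right h3 (by positivity)
  have h5 : ‖y - z‖ = 0 := by nlinarith [norm_nonneg (y - z)]
  exact sub_eq_zero.1 (norm_eq_zero.1 h5)

variable [MeasurableSpace 𝓢]

/-- For a measurable family of weakly convex functions there is a measurable selection of the
subdifferentials at `x` which attains the directional derivatives in the direction `d`. -/
theorem exists_subgradSelection {f : EuclideanSpace ℝ (Fin n) → 𝓢 → ℝ} {ρ : 𝓢 → ℝ}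
    (hfmeas : ∀ x, Measurable (f x)) (hρmeas : Measurable ρ)
    (hweak : ∀ s, IsWeaklyConvex (ρ s) (fun x => f x s)) (x d : EuclideanSpace ℝ (Fin n)) :
    ∃ g, IsSubgradSelection f x g ∧
      (∀ s y, f x s + inner ℝ (g s) (y - x) - ρ s / 2 * ‖y - x‖ ^ 2 ≤ f y s) ∧
      ∀ s, inner ℝ (g s) d = dirDeriv (fun y => f y s + ρ s / 2 * ‖y - x‖ ^ 2) x d := by
  obtain ⟨g, gm, hg, hd⟩ := exists_measurable_subgradient
    (ψ := fun y s => f y s + ρ s / 2 * ‖y - x‖ ^ 2)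
    (fun u => (hfmeas u).add ((hρmeas.div_const 2).mul_const _))
    (fun s => (hweak s).convexOn_add_sq x) x d
  have hle : ∀ s y, f x s + inner ℝ (g s) (y - x) - ρ s / 2 * ‖y - x‖ ^ 2 ≤ f y s := by
    intro s y
    have := hg s y
    simp only [sub_self, norm_zero] at this
    linarith
  exact ⟨g, ⟨gm, fun s => mem_frechetSubdiffOn_of_forall_le fun y _ => hle s y⟩, hle, hd⟩

theorem exists_isModelUpdate {X : Set (EuclideanSpace ℝ (Fin n))} (hXc : IsClosed X)
    (hXne : X.Nonempty) {f : EuclideanSpace ℝ (Fin n) → 𝓢 → ℝ} {ρ : 𝓢 → ℝ}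
    (hfmeas : ∀ x, Measurable (f x)) (hρmeas : Measurable ρ)
    (hweak : ∀ s, IsWeaklyConvex (ρ s) (fun x => f x s)) {α : ℝ} (hα : 0 < α)
    (x : EuclideanSpace ℝ (Fin n)) (s : 𝓢) :
    ∃ z, IsModelUpdate X (proxModel f ρ) α s x z := by
  obtain ⟨x₀, hx₀⟩ := hXne
  obtain ⟨g, -, hg, -⟩ := exists_subgradSelection hfmeas hρmeas hweak x 0
  have hcont : Continuous fun y => proxModel f ρ x y s + 1 / (2 * α) * ‖y - x‖ ^ 2 := by
    have := (hweak s).continuous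
    unfold proxModel
    fun_prop
  have hnorm : Tendsto (fun y => ‖y - x‖) (cocompact (EuclideanSpace ℝ (Fin n))) atTop :=
    (tendsto_norm_cocompact_atTop).comp (Homeomorph.subRight x).isClosedEmbedding.tendsto_cocompact
  -- The subgradient inequality cancels the `ρ` term of the model, leaving a linear minorant plus
  -- the positive quadratic `1/(2α) ‖y - x‖²`.
  have hlow : Tendsto (fun y => f x s + ‖y - x‖ * (1 / (2 * α) * ‖y - x‖ - ‖g s‖))
      (cocompact (EuclideanSpace ℝ (Fin n))) atTop := by
    refine tendsto_atTop_add_const_left _ _ (hnorm.atTop_mul_atTop₀ ?_)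
    exact tendsto_atTop_add_const_right _ _ (hnorm.const_mul_atTop (by positivity))
  have hco : Tendsto (fun y => proxModel f ρ x y s + 1 / (2 * α) * ‖y - x‖ ^ 2)
      (cocompact (EuclideanSpace ℝ (Fin n))) atTop := by
    refine tendsto_atTop_mono (fun y => ?_) hlow
    have h1 := hg s y
    have h2 := abs_le.1 (abs_real_inner_le_norm (g s) (y - x))
    unfold proxModel
    nlinarith [h2.1]
  obtain ⟨z, hz, hmin⟩ := hcont.continuousOn.exists_isMinOn' hXc hx₀
    ((hco.eventually_ge_atTop _).filter_mono inf_le_left)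
  exact ⟨z, hz, fun y hy => hmin hy⟩

theorem measurable_of_isModelUpdate {X : Set (EuclideanSpace ℝ (Fin n))} (hXconvex : Convex ℝ X)
    {f : EuclideanSpace ℝ (Fin n) → 𝓢 → ℝ} {ρ : 𝓢 → ℝ}
    (hfmeas : ∀ x, Measurable (f x)) (hρmeas : Measurable ρ)
    (hweak : ∀ s, IsWeaklyConvex (ρ s) (fun x => f x s)) {α : ℝ} (hα : 0 < α)
    {z : EuclideanSpace ℝ (Fin n) × 𝓢 → EuclideanSpace ℝ (Fin n)}
    (hz : ∀ p, IsModelUpdate X (proxModel f ρ) α p.2 p.1 (z p)) : Measurable z := by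
  refine measurable_of_sq_growth (X := X) (c := 1 / (2 * α))
    (J := fun p y => proxModel f ρ p.1 y p.2 + 1 / (2 * α) * ‖y - p.1‖ ^ 2) (by positivity)
    (fun y _ => ?_) (fun p => ?_) (fun p => (hz p).1)
    fun p y hy => (hz p).sq_growth hXconvex hweak hy
  · have := hfmeas y
    unfold proxModel
    fun_prop
  · have := (hweak p.2).continuous
    unfold proxModel
    fun_prop

end WeaklyConvex

/-! ### Proximal points of the population loss and subgradients adapted to a direction. -/

section

variable {n : ℕ} {𝓢 : Type*} [MeasurableSpace 𝓢]

/-- A stochastic weakly convex problem with a minimizer and relatively bounded variance. -/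
structure StochasticWeaklyConvexProblem (X : Set (EuclideanSpace ℝ (Fin n)))
    (f : EuclideanSpace ℝ (Fin n) → 𝓢 → ℝ) (ρ : 𝓢 → ℝ) (P : Measure 𝓢) : Prop where
  isClosed : IsClosed X
  convex : Convex ℝ X
  measurable : ∀ x, Measurable (f x)
  integrable : ∀ x ∈ X, Integrable (f x) P
  measurable_modulus : Measurable ρ
  memLp_modulus : MemLp ρ 2 P
  isWeaklyConvex : ∀ s, IsWeaklyConvex (ρ s) (fun x => f x s)
  nonempty_optimalSet : (optimalSet X (populationLoss f P)).Nonempty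
  relativeVarianceBound : RelativeVarianceBound X f P

namespace StochasticWeaklyConvexProblem

variable {X : Set (EuclideanSpace ℝ (Fin n))} {f : EuclideanSpace ℝ (Fin n) → 𝓢 → ℝ} {ρ : 𝓢 → ℝ}
  {P : Measure 𝓢} [IsProbabilityMeasure P]

theorem integrable_modulus (h : StochasticWeaklyConvexProblem X f ρ P) : Integrable ρ P :=
  h.memLp_modulus.integrable (by norm_num)

/-- The population loss is sequentially lower semicontinuous on the constraint set. -/
theorem populationLoss_le_of_tendsto (h : StochasticWeaklyConvexProblem X f ρ P)
    {y : ℕ → EuclideanSpace ℝ (Fin n)} {z : EuclideanSpace ℝ (Fin n)} {M : ℝ}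
    (hyX : ∀ k, y k ∈ X) (hzX : z ∈ X) (hy : Tendsto y atTop (𝓝 z))
    (hM : Tendsto (fun k => populationLoss f P (y k)) atTop (𝓝 M)) :
    populationLoss f P z ≤ M := by
  obtain ⟨x₀, hx₀X, hx₀⟩ := h.nonempty_optimalSet
  obtain ⟨g, gsel, hg, -⟩ := exists_subgradSelection h.measurable h.measurable_modulus
    h.isWeaklyConvex x₀ 0
  -- With the zero subgradient at a minimizer, the variance bound makes `g` integrable, so `l y` is
  -- an integrable quadratic minorant of `f y` and Fatou applies to the differences.
  have h0 : (0 : EuclideanSpace ℝ (Fin n)) ∈ frechetSubdiffOn X (populationLoss f P) x₀ :=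
    mem_frechetSubdiffOn_of_forall_le (r := 0) fun y hy => by simpa using hx₀ y hy
  obtain ⟨C₁, C₂, hC⟩ := h.relativeVarianceBound
  have hg1 : Integrable g P := (hC x₀ hx₀X g gsel 0 h0).1.integrable (by norm_num)
  let l : EuclideanSpace ℝ (Fin n) → 𝓢 → ℝ := fun y s =>
    f x₀ s + inner ℝ (g s) (y - x₀) - ρ s / 2 * ‖y - x₀‖ ^ 2
  let L : EuclideanSpace ℝ (Fin n) → ℝ := fun y =>
    populationLoss f P x₀ + inner ℝ (∫ s, g s ∂P) (y - x₀) - (∫ s, ρ s ∂P) / 2 * ‖y - x₀‖ ^ 2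
  have i1 := h.integrable x₀ hx₀X
  have i2 : ∀ y, Integrable (fun s => inner ℝ (g s) (y - x₀)) P := fun y => hg1.inner_const _
  have i12 : ∀ y, Integrable (fun s => f x₀ s + inner ℝ (g s) (y - x₀)) P := fun y =>
    i1.add (i2 y)
  have i3 : ∀ y, Integrable (fun s => ρ s / 2 * ‖y - x₀‖ ^ 2) P := fun y =>
    (h.integrable_modulus.div_const 2).mul_const _
  have hl : ∀ y, Integrable (l y) P := fun y => (i12 y).sub (i3 y)
  have hL : ∀ y, ∫ s, l y s ∂P = L y := by
    intro y
    simp only [l, L]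
    rw [integral_sub (i12 y) (i3 y), integral_add i1 (i2 y), integral_mul_const,
      integral_div]
    simp_rw [real_inner_comm (y - x₀)]
    rw [integral_inner hg1]
    rfl
  have hΛ : ∀ y ∈ X, ∫⁻ s, ENNReal.ofReal (f y s - l y s) ∂P =
      ENNReal.ofReal (populationLoss f P y - L y) := by
    intro y hy
    rw [← hL, populationLoss, ← integral_sub (h.integrable y hy) (hl y)]
    exact (ofReal_integral_eq_lintegral_ofReal (f := fun s => f y s - l y s)
      ((h.integrable y hy).sub (hl y)) (ae_of_all _ fun s => sub_nonneg.2 (hg s y))).symm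
  have hLnn : 0 ≤ M - L z := by
    have hLc : Tendsto (fun k => populationLoss f P (y k) - L (y k)) atTop (𝓝 (M - L z)) :=
      hM.sub ((Continuous.tendsto (by fun_prop) z).comp hy)
    refine ge_of_tendsto' hLc fun k => ?_
    rw [← hL, populationLoss, ← integral_sub (h.integrable _ (hyX k)) (hl _)]
    exact integral_nonneg fun s => sub_nonneg.2 (hg s _)
  have hfatou := lintegral_liminf_le (μ := P) (u := atTop)
    (f := fun k s => ENNReal.ofReal (f (y k) s - l (y k) s)) (fun k => by
      have := h.measurable (y k)
      have := h.measurable x₀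
      have := gsel.1
      have := h.measurable_modulus
      simp only [l]
      fun_prop)
  have e1 : ∀ s, liminf (fun k => ENNReal.ofReal (f (y k) s - l (y k) s)) atTop =
      ENNReal.ofReal (f z s - l z s) := by
    intro s
    refine Tendsto.liminf_eq (ENNReal.tendsto_ofReal ?_)
    have hc := (h.isWeaklyConvex s).continuous
    exact (Continuous.tendsto (f := fun y => f y s - l y s)
      (by simp only [l]; fun_prop) z).comp hy
  have e2 : liminf (fun k => ∫⁻ s, ENNReal.ofReal (f (y k) s - l (y k) s) ∂P) atTop =
      ENNReal.ofReal (M - L z) := by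
    refine Tendsto.liminf_eq ?_
    simp_rw [fun k => hΛ (y k) (hyX k)]
    exact ENNReal.tendsto_ofReal (hM.sub ((Continuous.tendsto (by fun_prop) z).comp hy))
  simp_rw [e1] at hfatou
  rw [e2, hΛ z hzX, ENNReal.ofReal_le_ofReal_iff hLnn] at hfatou
  linarith

/-- Existence of the proximal point of the constrained population loss. -/
theorem exists_proximal_point (h : StochasticWeaklyConvexProblem X f ρ P) {c : ℝ} (hc : 0 < c)
    (x : EuclideanSpace ℝ (Fin n)) :
    ∃ z ∈ X, ∀ y ∈ X, populationLoss f P z + c / 2 * ‖z - x‖ ^ 2 ≤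
      populationLoss f P y + c / 2 * ‖y - x‖ ^ 2 := by
  obtain ⟨x₀, hx₀X, hx₀⟩ := h.nonempty_optimalSet
  let φ : EuclideanSpace ℝ (Fin n) → ℝ := fun y => populationLoss f P y + c / 2 * ‖y - x‖ ^ 2
  have hbdd : BddBelow (φ '' X) := by
    refine ⟨populationLoss f P x₀, forall_mem_image.2 fun y hy => ?_⟩
    have := hx₀ y hy
    simp only [φ]
    nlinarith [sq_nonneg ‖y - x‖]
  obtain ⟨u, uanti, ulim, hu⟩ := exists_seq_tendsto_sInf (Set.Nonempty.image φ ⟨x₀, hx₀X⟩) hbdd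
  choose y hyX hyu using hu
  -- The radius comes from `F ≥ F x₀` on `X` and the crude bound `t ≤ 1 + t²`.
  have hball : ∀ k, y k ∈ Metric.closedBall x (1 + 2 / c * (u 0 - populationLoss f P x₀)) := by
    intro k
    rw [mem_closedBall_iff_norm]
    have h1 : φ (y k) ≤ u 0 := (hyu k).trans_le (uanti (Nat.zero_le k))
    have h2 := hx₀ _ (hyX k)
    have h3 : c / 2 * ‖y k - x‖ ^ 2 ≤ u 0 - populationLoss f P x₀ := by
      simp only [φ] at h1
      linarith
    have h4 : ‖y k - x‖ ^ 2 ≤ 2 / c * (u 0 - populationLoss f P x₀) := by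
      have := mul_le_mul_of_nonneg_left h3 (by positivity : 0 ≤ 2 / c)
      have e : 2 / c * (c / 2 * ‖y k - x‖ ^ 2) = ‖y k - x‖ ^ 2 := by field_simp
      rwa [e] at this
    nlinarith [sq_nonneg (‖y k - x‖ - 1)]
  obtain ⟨z, -, θ, hθ, hz⟩ := tendsto_subseq_of_bounded Metric.isBounded_closedBall hball
  have hzX : z ∈ X := h.isClosed.mem_of_tendsto hz (Eventually.of_forall fun k => hyX _)
  have hq : Tendsto (fun k => c / 2 * ‖(y ∘ θ) k - x‖ ^ 2) atTop (𝓝 (c / 2 * ‖z - x‖ ^ 2)) :=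
    (Continuous.tendsto (f := fun v => c / 2 * ‖v - x‖ ^ 2) (by fun_prop) z).comp hz
  have hF : Tendsto (fun k => populationLoss f P ((y ∘ θ) k)) atTop
      (𝓝 (sInf (φ '' X) - c / 2 * ‖z - x‖ ^ 2)) := by
    refine ((ulim.comp hθ.tendsto_atTop).sub hq).congr fun k => ?_
    have := hyu (θ k)
    simp only [φ, Function.comp] at this ⊢
    linarith
  have hle := h.populationLoss_le_of_tendsto (fun k => hyX _) hzX hz hF
  refine ⟨z, hzX, fun w hw => ?_⟩
  have := csInf_le hbdd (mem_image_of_mem φ hw)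
  simp only [φ] at this hle
  linarith

/-- A subgradient selection at the proximal point whose mean dominates the proximal subgradient
in a given feasible direction. -/
theorem exists_subgradSelection_at_proximal_point (h : StochasticWeaklyConvexProblem X f ρ P)
    {c : ℝ} {x z : EuclideanSpace ℝ (Fin n)} (hzX : z ∈ X)
    (hz : ∀ y ∈ X, populationLoss f P z + c / 2 * ‖z - x‖ ^ 2 ≤
      populationLoss f P y + c / 2 * ‖y - x‖ ^ 2)
    {C₁ C₂ : ℝ} (hC : ∀ x ∈ X, ∀ g, IsSubgradSelection f x g →
      ∀ v ∈ frechetSubdiffOn X (populationLoss f P) x,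
      MemLp g 2 P ∧ ∫ s, ‖g s - ∫ t, g t ∂P‖ ^ 2 ∂P ≤ C₁ * ‖v‖ ^ 2 + C₂)
    {y : EuclideanSpace ℝ (Fin n)} (hy : y ∈ X) :
    ∃ g : 𝓢 → EuclideanSpace ℝ (Fin n), MemLp g 2 P ∧
      ∫ s, ‖g s - ∫ t, g t ∂P‖ ^ 2 ∂P ≤ C₁ * (c ^ 2 * ‖x - z‖ ^ 2) + C₂ ∧
      (∀ s w, f z s + inner ℝ (g s) (w - z) - ρ s / 2 * ‖w - z‖ ^ 2 ≤ f w s) ∧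
      inner ℝ (c • (x - z)) (y - z) ≤ inner ℝ (∫ s, g s ∂P) (y - z) := by
  obtain ⟨g, gsel, hg, hd⟩ := exists_subgradSelection h.measurable h.measurable_modulus
    h.isWeaklyConvex z (y - z)
  have hlow : ∀ w ∈ X, populationLoss f P z + inner ℝ (c • (x - z)) (w - z) -
      c / 2 * ‖w - z‖ ^ 2 ≤ populationLoss f P w := by
    intro w hw
    have h1 := hz w hw
    rw [norm_sub_sq_expand x w z] at h1
    rw [inner_smul_left]
    simp only [conj_trivial]
    linarith
  -- The proximal inequality `hlow` exhibits `c (x - z)` as a Fréchet subgradient, to which the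
  -- variance bound applies.
  obtain ⟨g2, gvar⟩ := hC z hzX g gsel _ (mem_frechetSubdiffOn_of_forall_le hlow)
  have hg1 : Integrable g P := g2.integrable (by norm_num)
  rw [norm_smul, mul_pow, Real.norm_eq_abs, sq_abs] at gvar
  refine ⟨g, g2, gvar, hg, ?_⟩
  set d := y - z with hd_def
  let ψ : EuclideanSpace ℝ (Fin n) → 𝓢 → ℝ := fun w s => f w s + ρ s / 2 * ‖w - z‖ ^ 2
  have hψ : ∀ s, ConvexOn ℝ univ fun w => ψ w s := fun s =>
    (h.isWeaklyConvex s).convexOn_add_sq z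
  let q : ℕ → 𝓢 → ℝ := fun k s => ((k : ℝ) + 1) * (ψ (z + ((k : ℝ) + 1)⁻¹ • d) s - ψ z s)
  have hw : ∀ k : ℕ, z + ((k : ℝ) + 1)⁻¹ • d ∈ X := by
    intro k
    have e : z + ((k : ℝ) + 1)⁻¹ • d = (1 - ((k : ℝ) + 1)⁻¹) • z + ((k : ℝ) + 1)⁻¹ • y := by
      rw [hd_def]
      module
    rw [e]
    have : ((k : ℝ) + 1)⁻¹ ≤ 1 := inv_le_one_of_one_le₀ (by linarith [k.cast_nonneg (α := ℝ)])
    exact h.convex hzX hy (by linarith) (by positivity) (by ring)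
  have iψ : ∀ w ∈ X, Integrable (ψ w) P := fun w hw =>
    (h.integrable w hw).add ((h.integrable_modulus.div_const 2).mul_const _)
  have iq : ∀ k, Integrable (q k) P := fun k =>
    ((iψ _ (hw k)).sub (iψ z hzX)).const_mul _
  have ig : Integrable (fun s => inner ℝ (g s) d) P := hg1.inner_const d
  have hmean : ∫ s, inner ℝ (g s) d ∂P = inner ℝ (∫ s, g s ∂P) d := by
    simp_rw [real_inner_comm d]
    exact integral_inner hg1 d
  have hqlow : ∀ k s, inner ℝ (g s) d ≤ q k s := by
    intro k s
    have h1 := hg s (z + ((k : ℝ) + 1)⁻¹ • d)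
    rw [add_sub_cancel_left, inner_smul_right] at h1
    simp only [q, ψ, add_sub_cancel_left, sub_self, norm_zero]
    have h2 : ((k : ℝ) + 1)⁻¹ * inner ℝ (g s) d ≤
        f (z + ((k : ℝ) + 1)⁻¹ • d) s + ρ s / 2 * ‖((k : ℝ) + 1)⁻¹ • d‖ ^ 2 -
          (f z s + ρ s / 2 * 0 ^ 2) := by linarith
    have h3 := mul_le_mul_of_nonneg_left h2 (by positivity : 0 ≤ (k : ℝ) + 1)
    rwa [mul_inv_cancel_left₀ (by positivity)] at h3
  have hqup : ∀ k s, q k s ≤ ψ y s - ψ z s := by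
    intro k s
    have ht : ((k : ℝ) + 1)⁻¹ ≤ 1 := inv_le_one_of_one_le₀ (by linarith [k.cast_nonneg (α := ℝ)])
    have e : z + ((k : ℝ) + 1)⁻¹ • d = (1 - ((k : ℝ) + 1)⁻¹) • z + ((k : ℝ) + 1)⁻¹ • y := by
      rw [hd_def]
      module
    have h1 := (hψ s).2 (mem_univ z) (mem_univ y) (sub_nonneg.2 ht)
      (by positivity : 0 ≤ ((k : ℝ) + 1)⁻¹) (by ring)
    rw [← e] at h1
    simp only [smul_eq_mul] at h1
    have h2 : ψ (z + ((k : ℝ) + 1)⁻¹ • d) s - ψ z s ≤ ((k : ℝ) + 1)⁻¹ * (ψ y s - ψ z s) := by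
      linarith
    have h3 := mul_le_mul_of_nonneg_left h2 (by positivity : 0 ≤ (k : ℝ) + 1)
    rwa [mul_inv_cancel_left₀ (by positivity)] at h3
  -- Convexity traps the quotients between `⟪g s, d⟫` and the unit-step increment; their limit is
  -- `⟪g s, d⟫` because `g` attains the directional derivative.
  have hlim : Tendsto (fun k => ∫ s, q k s ∂P) atTop (𝓝 (inner ℝ (∫ s, g s ∂P) d)) := by
    rw [← hmean]
    refine tendsto_integral_of_dominated_convergence
      (fun s => |inner ℝ (g s) d| + |ψ y s - ψ z s|) (fun k => (iq k).aestronglyMeasurable)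
      (ig.abs.add ((iψ y hy).sub (iψ z hzX)).abs) (fun k => ae_of_all _ fun s => ?_)
      (ae_of_all _ fun s => ?_)
    · rw [Real.norm_eq_abs, abs_le]
      constructor
      · linarith [hqlow k s, neg_abs_le (inner ℝ (g s) d), abs_nonneg (ψ y s - ψ z s)]
      · linarith [hqup k s, le_abs_self (ψ y s - ψ z s), abs_nonneg (inner ℝ (g s) d)]
    · rw [hd s]
      exact (hψ s).tendsto_dirDeriv_seq z d
  have hint : ∀ w ∈ X, ∫ s, ψ w s ∂P =
      populationLoss f P w + (∫ s, ρ s ∂P) / 2 * ‖w - z‖ ^ 2 := by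
    intro w hw
    simp only [ψ]
    rw [integral_add (h.integrable w hw) ((h.integrable_modulus.div_const 2).mul_const _),
      integral_mul_const, integral_div]
    rfl
  -- The proximal inequality bounds the same quotients from below in mean, up to an error of order
  -- `1/(k+1)`.
  have hlow_q : ∀ k : ℕ, inner ℝ (c • (x - z)) d +
      ((k : ℝ) + 1)⁻¹ * (((∫ s, ρ s ∂P) - c) / 2 * ‖d‖ ^ 2) ≤ ∫ s, q k s ∂P := by
    intro k
    simp only [q]
    rw [integral_const_mul, integral_sub (iψ _ (hw k)) (iψ z hzX), hint _ (hw k), hint z hzX]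
    have h1 := hlow _ (hw k)
    rw [add_sub_cancel_left, inner_smul_right, norm_smul, mul_pow, Real.norm_eq_abs, sq_abs] at h1
    rw [add_sub_cancel_left, norm_smul, mul_pow, Real.norm_eq_abs, sq_abs, sub_self, norm_zero]
    have hk : (0 : ℝ) < (k : ℝ) + 1 := by positivity
    have h2 : ((k : ℝ) + 1)⁻¹ * (inner ℝ (c • (x - z)) d +
        ((k : ℝ) + 1)⁻¹ * (((∫ s, ρ s ∂P) - c) / 2 * ‖d‖ ^ 2)) ≤
        populationLoss f P (z + ((k : ℝ) + 1)⁻¹ • d) +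
          (∫ s, ρ s ∂P) / 2 * (((k : ℝ) + 1)⁻¹ ^ 2 * ‖d‖ ^ 2) -
          (populationLoss f P z + (∫ s, ρ s ∂P) / 2 * 0 ^ 2) := by
      linarith
    have h3 := mul_le_mul_of_nonneg_left h2 hk.le
    rwa [mul_inv_cancel_left₀ hk.ne'] at h3
  have hlim2 : Tendsto (fun k : ℕ => inner ℝ (c • (x - z)) d +
      ((k : ℝ) + 1)⁻¹ * (((∫ s, ρ s ∂P) - c) / 2 * ‖d‖ ^ 2)) atTop
      (𝓝 (inner ℝ (c • (x - z)) d + 0 * (((∫ s, ρ s ∂P) - c) / 2 * ‖d‖ ^ 2))) := by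
    refine tendsto_const_nhds.add (Tendsto.mul_const _ ?_)
    simpa using tendsto_one_div_add_atTop_nhds_zero_nat (𝕜 := ℝ)
  rw [zero_mul, add_zero] at hlim2
  exact le_of_tendsto_of_tendsto' hlim2 hlim hlow_q

end StochasticWeaklyConvexProblem

end

/-! ### The one-step estimate and the Moreau envelope. -/

section

variable {n : ℕ} {𝓢 : Type*}

/-- Pathwise estimate of one proximal step, relative to a comparison point `z`. -/
theorem IsModelUpdate.norm_sq_le {X : Set (EuclideanSpace ℝ (Fin n))} (hXconvex : Convex ℝ X)
    {f : EuclideanSpace ℝ (Fin n) → 𝓢 → ℝ} {ρ : 𝓢 → ℝ}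
    (hweak : ∀ s, IsWeaklyConvex (ρ s) (fun x => f x s)) {α : ℝ} (hα : 0 < α) {s : 𝓢}
    {x x' z g : EuclideanSpace ℝ (Fin n)} (h : IsModelUpdate X (proxModel f ρ) α s x x')
    (hz : z ∈ X)
    (hg : ∀ w, f z s + inner ℝ g (w - z) - ρ s / 2 * ‖w - z‖ ^ 2 ≤ f w s)
    (c : ℝ) (m : EuclideanSpace ℝ (Fin n)) :
    ‖x' - z‖ ^ 2 ≤ ‖x - z‖ ^ 2 + 2 * α * inner ℝ ((ρ s - c) • (x - z) - (g - m)) (x - z) +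
      2 * α * inner ℝ (c • (x - z) - m) (x' - z) +
      α ^ 2 * ‖(ρ s - c) • (x - z) - (g - m)‖ ^ 2 := by
  have h1 := h.sq_growth hXconvex hweak hz
  have h2 := hg x'
  unfold proxModel at h1
  rw [norm_sub_rev z x', norm_sub_rev z x] at h1
  have e : x' - x = (x' - z) - (x - z) := by abel
  rw [e] at h1
  generalize x' - z = b at *
  generalize x - z = a at *
  set q := (ρ s - c) • a - (g - m) with hq
  -- The three `ρ` quadratics, from the model at both points and from weak convexity at `z`,
  -- collapse to `-ρ ⟪a, b⟫`.
  have h3 : inner ℝ g b - ρ s * inner ℝ a b +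
      1 / (2 * α) * (‖b - a‖ ^ 2 + ‖b‖ ^ 2 - ‖a‖ ^ 2) ≤ 0 := by
    have := norm_sub_sq_real b a
    rw [real_inner_comm] at this
    have h4 : ρ s / 2 * ‖b - a‖ ^ 2 = ρ s / 2 * (‖b‖ ^ 2 - 2 * inner ℝ a b + ‖a‖ ^ 2) := by
      rw [this]
    linarith
  have h5 : ‖b‖ ^ 2 ≤ ‖a‖ ^ 2 - ‖b - a‖ ^ 2 + 2 * α * (ρ s * inner ℝ a b - inner ℝ g b) := by
    have := mul_le_mul_of_nonneg_left h3 (by positivity : 0 ≤ 2 * α)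
    have e2 : 2 * α * (inner ℝ g b - ρ s * inner ℝ a b +
        1 / (2 * α) * (‖b - a‖ ^ 2 + ‖b‖ ^ 2 - ‖a‖ ^ 2)) =
        2 * α * (inner ℝ g b - ρ s * inner ℝ a b) + (‖b - a‖ ^ 2 + ‖b‖ ^ 2 - ‖a‖ ^ 2) := by
      field_simp
    linarith
  -- This is `‖α q - (b - a)‖² ≥ 0`: replacing `b` by `a` in `⟪q, b⟫` costs `α² ‖q‖²` and uses up
  -- the term `-‖b - a‖²` of `h5`.
  have h6 : 0 ≤ α ^ 2 * ‖q‖ ^ 2 - 2 * α * (inner ℝ q b - inner ℝ q a) + ‖b - a‖ ^ 2 := by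
    have h7 := norm_sub_sq_real (α • q) (b - a)
    rw [norm_smul, mul_pow, Real.norm_eq_abs, sq_abs, inner_smul_left, inner_sub_right] at h7
    simp only [conj_trivial] at h7
    nlinarith [sq_nonneg ‖α • q - (b - a)‖]
  have h8 : inner ℝ q b = (ρ s - c) * inner ℝ a b - (inner ℝ g b - inner ℝ m b) := by
    rw [hq]
    simp [inner_sub_left, inner_smul_left]
  have h9 : inner ℝ (c • a - m) b = c * inner ℝ a b - inner ℝ m b := by
    simp [inner_sub_left, inner_smul_left]
  rw [h9]
  linear_combination h5 + h6 - 2 * α * h8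

/-- The gap between the Moreau envelope of `F` on `X` and the infimum of `F` on `X`. -/
noncomputable def moreauGap (X : Set (EuclideanSpace ℝ (Fin n)))
    (F : EuclideanSpace ℝ (Fin n) → ℝ) (c : ℝ) (x : EuclideanSpace ℝ (Fin n)) : ℝ :=
  (⨅ y : X, (F y + c / 2 * ‖(y : EuclideanSpace ℝ (Fin n)) - x‖ ^ 2)) - ⨅ y : X, F y

section MoreauGap

variable {X : Set (EuclideanSpace ℝ (Fin n))} {F : EuclideanSpace ℝ (Fin n) → ℝ} {c : ℝ}

theorem bddBelow_moreau (hF : BddBelow (F '' X)) (hc : 0 ≤ c) (x : EuclideanSpace ℝ (Fin n)) :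
    BddBelow (range fun y : X => F y + c / 2 * ‖(y : EuclideanSpace ℝ (Fin n)) - x‖ ^ 2) := by
  obtain ⟨m, hm⟩ := hF
  refine ⟨m, forall_mem_range.2 fun y => ?_⟩
  have h1 := hm (mem_image_of_mem F y.2)
  have h2 : 0 ≤ c / 2 * ‖(y : EuclideanSpace ℝ (Fin n)) - x‖ ^ 2 := by positivity
  linarith

theorem moreauGap_le (hF : BddBelow (F '' X)) (hc : 0 ≤ c) (x : EuclideanSpace ℝ (Fin n))
    {y : EuclideanSpace ℝ (Fin n)} (hy : y ∈ X) :
    moreauGap X F c x ≤ F y + c / 2 * ‖y - x‖ ^ 2 - ⨅ y : X, F y :=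
  sub_le_sub_right (ciInf_le (bddBelow_moreau hF hc x) ⟨y, hy⟩) _

theorem moreauGap_eq (hF : BddBelow (F '' X)) (hc : 0 ≤ c) {x z : EuclideanSpace ℝ (Fin n)}
    (hz : z ∈ X) (hmin : ∀ y ∈ X, F z + c / 2 * ‖z - x‖ ^ 2 ≤ F y + c / 2 * ‖y - x‖ ^ 2) :
    moreauGap X F c x = F z + c / 2 * ‖z - x‖ ^ 2 - ⨅ y : X, F y := by
  have : Nonempty X := ⟨⟨z, hz⟩⟩
  exact le_antisymm (moreauGap_le hF hc x hz)
    (sub_le_sub_right (le_ciInf fun y : X => hmin y y.2) _)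

/-- An infimum of continuous functions of `x` is upper semicontinuous, even over an uncountable `X`.
-/
theorem measurable_moreauGap (hF : BddBelow (F '' X)) (hc : 0 ≤ c) :
    Measurable (moreauGap X F c) := by
  refine Measurable.sub_const (UpperSemicontinuous.measurable ?_) _
  exact upperSemicontinuous_ciInf (bddBelow_moreau hF hc) fun y =>
    Continuous.upperSemicontinuous (by fun_prop)

theorem ciInf_le_of_mem (hF : BddBelow (F '' X)) {z : EuclideanSpace ℝ (Fin n)} (hz : z ∈ X) :
    ⨅ y : X, F y ≤ F z :=
  ciInf_le (f := fun y : X => F y) (by rwa [image_eq_range] at hF) ⟨z, hz⟩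

theorem moreauGap_nonneg (hX : X.Nonempty) (hF : BddBelow (F '' X)) (hc : 0 ≤ c)
    (x : EuclideanSpace ℝ (Fin n)) : 0 ≤ moreauGap X F c x := by
  have : Nonempty X := hX.to_subtype
  refine sub_nonneg.2 (le_ciInf fun y => ?_)
  have h1 := ciInf_le_of_mem hF y.2
  have h2 : 0 ≤ c / 2 * ‖(y : EuclideanSpace ℝ (Fin n)) - x‖ ^ 2 := by positivity
  linarith

end MoreauGap

variable [MeasurableSpace 𝓢]

namespace StochasticWeaklyConvexProblem

variable {X : Set (EuclideanSpace ℝ (Fin n))} {f : EuclideanSpace ℝ (Fin n) → 𝓢 → ℝ} {ρ : 𝓢 → ℝ}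
  {P : Measure 𝓢} [IsProbabilityMeasure P]

/-- Expected squared distance to the proximal point after one stochastic proximal step. -/
theorem integral_norm_sq_step_le (h : StochasticWeaklyConvexProblem X f ρ P)
    {C₁ C₂ : ℝ} (hC : ∀ x ∈ X, ∀ g, IsSubgradSelection f x g →
      ∀ v ∈ frechetSubdiffOn X (populationLoss f P) x,
      MemLp g 2 P ∧ ∫ s, ‖g s - ∫ t, g t ∂P‖ ^ 2 ∂P ≤ C₁ * ‖v‖ ^ 2 + C₂)
    {c : ℝ} (hc : ∫ s, ρ s ∂P ≤ c) {x z : EuclideanSpace ℝ (Fin n)} (hzX : z ∈ X)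
    (hz : ∀ y ∈ X, populationLoss f P z + c / 2 * ‖z - x‖ ^ 2 ≤
      populationLoss f P y + c / 2 * ‖y - x‖ ^ 2)
    {α : ℝ} (hα : 0 < α) {x' : 𝓢 → EuclideanSpace ℝ (Fin n)} (hx'm : Measurable x')
    (hx' : ∀ s, IsModelUpdate X (proxModel f ρ) α s x (x' s)) :
    Integrable (fun s => ‖x' s - z‖ ^ 2) P ∧
    ∫ s, ‖x' s - z‖ ^ 2 ∂P ≤ ‖x - z‖ ^ 2 + α ^ 2 *
      (2 * (∫ s, (ρ s - c) ^ 2 ∂P) * ‖x - z‖ ^ 2 + 2 * (C₁ * (c ^ 2 * ‖x - z‖ ^ 2) + C₂)) := by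
  have hq2 : ∀ (c : ℝ) (m : EuclideanSpace ℝ (Fin n)) (g : 𝓢 → EuclideanSpace ℝ (Fin n)),
      MemLp g 2 P → MemLp (fun s => (ρ s - c) • (x - z) - (g s - m)) 2 P := by
    intro c m g hg
    have h1 : MemLp (fun s => ρ s - c) 2 P := h.memLp_modulus.sub (memLp_const c)
    have h2 := (ContinuousLinearMap.toSpanSingleton ℝ (x - z)).comp_memLp' h1
    exact MemLp.sub h2 (hg.sub (memLp_const m))
  -- Taking `c = m = 0` removes the cross term with `x'`, so the pathwise bound becomes an
  -- integrable majorant.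
  have hb2 : Integrable (fun s => ‖x' s - z‖ ^ 2) P := by
    obtain ⟨g, g2, -, hg, -⟩ := h.exists_subgradSelection_at_proximal_point hzX hz hC hzX
    have hq := hq2 0 0 g g2
    refine Integrable.mono' (g := fun s => ‖x - z‖ ^ 2 +
      2 * α * inner ℝ ((ρ s - 0) • (x - z) - (g s - 0)) (x - z) +
      α ^ 2 * ‖(ρ s - 0) • (x - z) - (g s - 0)‖ ^ 2) ?_ (by fun_prop) (ae_of_all _ fun s => ?_)
    · exact ((integrable_const _).add (((hq.integrable (by norm_num)).inner_const _).const_mul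
        _)).add (((memLp_two_iff_integrable_sq_norm hq.1).1 hq).const_mul _)
    · have := (hx' s).norm_sq_le h.convex h.isWeaklyConvex hα hzX (hg s) 0 0
      rw [Real.norm_of_nonneg (by positivity)]
      simpa using this
  refine ⟨hb2, ?_⟩
  have hb : Integrable (fun s => x' s - z) P :=
    ((memLp_two_iff_integrable_sq_norm (by fun_prop)).2 hb2).integrable (by norm_num)
  have hx'i : Integrable x' P := by
    exact (hb.add (integrable_const z)).congr (ae_of_all _ fun s => by simp)
  -- The mean of the step lies in `X`, hence `E x' - z` is a feasible direction at `z`. Being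
  -- deterministic, it can be fixed before `g` is chosen.
  have hmean : ∫ s, x' s ∂P ∈ X :=
    h.convex.integral_mem h.isClosed (ae_of_all _ fun s => (hx' s).1) hx'i
  have hd : ∫ s, (x' s - z) ∂P = (∫ s, x' s ∂P) - z := by
    rw [integral_sub hx'i (integrable_const z)]
    simp
  obtain ⟨g, g2, gvar, hg, gdir⟩ := h.exists_subgradSelection_at_proximal_point hzX hz hC hmean
  set m := ∫ s, g s ∂P with hm
  have hg1 : Integrable g P := g2.integrable (by norm_num)
  have hq := hq2 c m g g2
  set q : 𝓢 → EuclideanSpace ℝ (Fin n) := fun s => (ρ s - c) • (x - z) - (g s - m) with hqdef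
  have hqi : Integrable q P := hq.integrable (by norm_num)
  have hqsq : Integrable (fun s => ‖q s‖ ^ 2) P := (memLp_two_iff_integrable_sq_norm hq.1).1 hq
  have hρc : Integrable (fun s => (ρ s - c) ^ 2) P :=
    (h.memLp_modulus.sub (memLp_const c)).integrable_sq
  have hgm : Integrable (fun s => ‖g s - m‖ ^ 2) P :=
    (memLp_two_iff_integrable_sq_norm (g2.sub (memLp_const m)).1).1 (g2.sub (memLp_const m))
  have i1 : Integrable (fun s => inner ℝ (q s) (x - z)) P := hqi.inner_const _
  have i2 : Integrable (fun s => inner ℝ (c • (x - z) - m) (x' s - z)) P := hb.const_inner _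
  have eq1 : ∫ s, inner ℝ (q s) (x - z) ∂P = ((∫ s, ρ s ∂P) - c) * ‖x - z‖ ^ 2 := by
    simp_rw [real_inner_comm (x - z)]
    rw [integral_inner hqi, hqdef]
    have j1 : Integrable (fun s => (ρ s - c) • (x - z)) P :=
      (h.integrable_modulus.sub (integrable_const c)).smul_const _
    have j2 : Integrable (fun s => g s - m) P := hg1.sub (integrable_const m)
    rw [integral_sub j1 j2, integral_sub hg1 (integrable_const m),
      integral_smul_const, integral_sub h.integrable_modulus (integrable_const c), ← hm]
    simp [inner_smul_right]
  have eq2 : ∫ s, inner ℝ (c • (x - z) - m) (x' s - z) ∂P =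
      inner ℝ (c • (x - z) - m) ((∫ s, x' s ∂P) - z) := by
    rw [integral_inner hb, hd]
  have le3 : ∫ s, ‖q s‖ ^ 2 ∂P ≤ 2 * (∫ s, (ρ s - c) ^ 2 ∂P) * ‖x - z‖ ^ 2 +
      2 * (C₁ * (c ^ 2 * ‖x - z‖ ^ 2) + C₂) := by
    calc ∫ s, ‖q s‖ ^ 2 ∂P
        ≤ ∫ s, (2 * ((ρ s - c) ^ 2 * ‖x - z‖ ^ 2) + 2 * ‖g s - m‖ ^ 2) ∂P := by
          refine integral_mono hqsq (((hρc.mul_const _).const_mul _).add (hgm.const_mul _))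
            fun s => ?_
          have h1 := norm_sub_le ((ρ s - c) • (x - z)) (g s - m)
          have h2 : ‖(ρ s - c) • (x - z)‖ ^ 2 = (ρ s - c) ^ 2 * ‖x - z‖ ^ 2 := by
            rw [norm_smul, mul_pow, Real.norm_eq_abs, sq_abs]
          simp only [hqdef, ← h2]
          nlinarith [norm_nonneg ((ρ s - c) • (x - z) - (g s - m)),
            sq_nonneg (‖(ρ s - c) • (x - z)‖ - ‖g s - m‖)]
      _ = 2 * ((∫ s, (ρ s - c) ^ 2 ∂P) * ‖x - z‖ ^ 2) + 2 * ∫ s, ‖g s - m‖ ^ 2 ∂P := by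
          rw [integral_add ((hρc.mul_const _).const_mul _) (hgm.const_mul _), integral_const_mul,
            integral_const_mul, integral_mul_const]
      _ ≤ _ := by linarith
  calc ∫ s, ‖x' s - z‖ ^ 2 ∂P
      ≤ ∫ s, (‖x - z‖ ^ 2 + 2 * α * inner ℝ (q s) (x - z) +
          2 * α * inner ℝ (c • (x - z) - m) (x' s - z) + α ^ 2 * ‖q s‖ ^ 2) ∂P := by
        refine integral_mono hb2 ((((integrable_const _).add (i1.const_mul _)).add
          (i2.const_mul _)).add (hqsq.const_mul _)) fun s => ?_
        exact (hx' s).norm_sq_le h.convex h.isWeaklyConvex hα hzX (hg s) c m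
    _ = ‖x - z‖ ^ 2 + 2 * α * (((∫ s, ρ s ∂P) - c) * ‖x - z‖ ^ 2) +
          2 * α * inner ℝ (c • (x - z) - m) ((∫ s, x' s ∂P) - z) +
          α ^ 2 * ∫ s, ‖q s‖ ^ 2 ∂P := by
        have k1 : Integrable (fun s => ‖x - z‖ ^ 2 + 2 * α * inner ℝ (q s) (x - z)) P :=
          (integrable_const _).add (i1.const_mul _)
        have k2 : Integrable (fun s => ‖x - z‖ ^ 2 + 2 * α * inner ℝ (q s) (x - z) +
          2 * α * inner ℝ (c • (x - z) - m) (x' s - z)) P := k1.add (i2.const_mul _)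
        rw [integral_add k2 (hqsq.const_mul _), integral_add k1 (i2.const_mul _),
          integral_add (integrable_const _) (i1.const_mul _), integral_const_mul,
          integral_const_mul, integral_const_mul, eq1, eq2]
        simp
    _ ≤ _ := by
        rw [inner_sub_left]
        have t1 : 2 * α * (((∫ s, ρ s ∂P) - c) * ‖x - z‖ ^ 2) ≤ 0 :=
          mul_nonpos_of_nonneg_of_nonpos (by positivity)
            (mul_nonpos_of_nonpos_of_nonneg (by linarith) (by positivity))
        have t2 := mul_nonpos_of_nonneg_of_nonpos (by positivity : 0 ≤ 2 * α)
          (sub_nonpos.2 gdir)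
        have t3 := mul_le_mul_of_nonneg_left le3 (sq_nonneg α)
        linarith

/-- Almost-supermartingale estimate for the Moreau gap along a stochastic proximal step. -/
theorem exists_lintegral_moreauGap_step_le (h : StochasticWeaklyConvexProblem X f ρ P)
    (hF : BddBelow (populationLoss f P '' X)) {c : ℝ} (hc₀ : 0 < c) (hc : ∫ s, ρ s ∂P ≤ c) :
    ∃ C : ℝ, 0 ≤ C ∧ ∀ (α : ℝ), 0 < α → ∀ (x : EuclideanSpace ℝ (Fin n))
      (x' : 𝓢 → EuclideanSpace ℝ (Fin n)), Measurable x' →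
      (∀ s, IsModelUpdate X (proxModel f ρ) α s x (x' s)) →
      ∫⁻ s, ENNReal.ofReal (moreauGap X (populationLoss f P) c (x' s) + 1) ∂P ≤
        ENNReal.ofReal (1 + C * α ^ 2) *
          ENNReal.ofReal (moreauGap X (populationLoss f P) c x + 1) := by
  obtain ⟨C₁, C₂, hC⟩ := h.relativeVarianceBound
  have hR : 0 ≤ ∫ s, (ρ s - c) ^ 2 ∂P := integral_nonneg fun s => sq_nonneg _
  set R := ∫ s, (ρ s - c) ^ 2 ∂P with hRdef
  -- The constant is `c/2` times the bracket multiplying `α²`, after using `c/2 ‖x - z‖² ≤ V`; the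
  -- `+ 1` in `V + 1` absorbs the additive `c |C₂|`.
  refine ⟨2 * R + 2 * |C₁| * c ^ 2 + c * |C₂|, by positivity, fun α hα x x' hx'm hx' => ?_⟩
  obtain ⟨z, hzX, hz⟩ := h.exists_proximal_point hc₀ x
  obtain ⟨hb2, hb⟩ := h.integral_norm_sq_step_le hC hc hzX hz hα hx'm hx'
  rw [← hRdef] at hb
  have hV := moreauGap_eq hF hc₀.le hzX hz
  rw [norm_sub_rev z x] at hV
  have hFz := ciInf_le_of_mem hF hzX
  set V := moreauGap X (populationLoss f P) c x with hVdef
  set Fm := ⨅ y : X, populationLoss f P y with hFm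
  have hVnn : 0 ≤ V := moreauGap_nonneg ⟨z, hzX⟩ hF hc₀.le x
  have hi : Integrable (fun s => populationLoss f P z - Fm + 1 + c / 2 * ‖x' s - z‖ ^ 2) P :=
    (integrable_const _).add (hb2.const_mul _)
  have hstep : ∫⁻ s, ENNReal.ofReal (moreauGap X (populationLoss f P) c (x' s) + 1) ∂P ≤
      ENNReal.ofReal (populationLoss f P z - Fm + 1 + c / 2 * ∫ s, ‖x' s - z‖ ^ 2 ∂P) := by
    have e : populationLoss f P z - Fm + 1 + c / 2 * ∫ s, ‖x' s - z‖ ^ 2 ∂P =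
        ∫ s, (populationLoss f P z - Fm + 1 + c / 2 * ‖x' s - z‖ ^ 2) ∂P := by
      rw [integral_add (integrable_const _) (hb2.const_mul _), integral_const_mul]
      simp
    rw [e, ofReal_integral_eq_lintegral_ofReal hi (ae_of_all _ fun s => ?_)]
    · refine lintegral_mono fun s => ENNReal.ofReal_le_ofReal ?_
      have := moreauGap_le hF hc₀.le (x' s) hzX
      rw [norm_sub_rev z] at this
      linarith
    · have : 0 ≤ c / 2 * ‖x' s - z‖ ^ 2 := by positivity
      simp only [Pi.zero_apply]
      linarith
  rw [← ENNReal.ofReal_mul (by positivity)]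
  refine hstep.trans (ENNReal.ofReal_le_ofReal ?_)
  have hA : c / 2 * ‖x - z‖ ^ 2 ≤ V := by linarith
  have h1 := mul_le_mul_of_nonneg_left hb (by positivity : 0 ≤ c / 2)
  have h2 : C₁ * (c ^ 2 * ‖x - z‖ ^ 2) ≤ |C₁| * (c ^ 2 * ‖x - z‖ ^ 2) :=
    mul_le_mul_of_nonneg_right (le_abs_self _) (by positivity)
  have h3 := le_abs_self C₂
  have h4 : c / 2 * (2 * R * ‖x - z‖ ^ 2 + 2 * (C₁ * (c ^ 2 * ‖x - z‖ ^ 2) + C₂)) ≤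
      (2 * R + 2 * |C₁| * c ^ 2 + c * |C₂|) * (V + 1) := by
    have k1 := mul_le_mul_of_nonneg_left hA (by positivity : 0 ≤ 2 * R + 2 * |C₁| * c ^ 2)
    have k2 := mul_le_mul_of_nonneg_left h2 hc₀.le
    have k3 := mul_le_mul_of_nonneg_left h3 hc₀.le
    have k4 : 0 ≤ 2 * R + 2 * |C₁| * c ^ 2 := by positivity
    have k5 : 0 ≤ c * |C₂| * V := by positivity
    linarith
  have h5 := mul_le_mul_of_nonneg_left h4 (sq_nonneg α)
  linarith

end StochasticWeaklyConvexProblem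

end

/-! ### A maximal inequality for recursions driven by independent noise. -/

section MarkovRecursion

variable {E 𝓢 Ω : Type*} [MeasurableSpace E] [MeasurableSpace 𝓢] [MeasurableSpace Ω]
  {P : Measure 𝓢} {μ : Measure Ω}

theorem indepFun_past_next {S : ℕ → Ω → 𝓢} (hS : ∀ k, Measurable (S k)) (hind : iIndepFun S μ)
    {G : Type*} [MeasurableSpace G] {k : ℕ} {Y : Ω → G}
    (hY : Measurable[⨆ j ∈ Iio k, MeasurableSpace.comap (S j) inferInstance] Y) :
    IndepFun Y (S k) μ := by
  have h := indep_iSup_of_disjoint (fun j => (hS j).comap_le) hind.iIndep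
    (S := Iio k) (T := {k}) (by simp)
  rw [IndepFun_iff_Indep]
  refine indep_of_indep_of_le_left (indep_of_indep_of_le_right h ?_) hY.comap_le
  simp

/-- Maximal inequality for a nonnegative function of a Markov recursion driven by i.i.d. noise
which is multiplied in mean by at most `b k` in step `k`. -/
theorem ae_bddAbove_of_lintegral_step_le [IsProbabilityMeasure P] [IsProbabilityMeasure μ]
    {S : ℕ → Ω → 𝓢} (hS : ∀ k, Measurable (S k)) (hSlaw : ∀ k, μ.map (S k) = P)
    (hind : iIndepFun S μ) {x : ℕ → Ω → E} {x₁ : E} (hx₁ : ∀ ω, x 0 ω = x₁)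
    {T : ℕ → E × 𝓢 → E} (hT : ∀ k, Measurable (T k))
    (hx : ∀ k ω, x (k + 1) ω = T k (x k ω, S k ω))
    {V : E → ENNReal} (hV : Measurable V) (hV₁ : V x₁ ≠ ⊤) {b : ℕ → ENNReal}
    (hstep : ∀ k y, ∫⁻ s, V (T k (y, s)) ∂P ≤ b k * V y)
    {B : ENNReal} (hB : B ≠ ⊤) (hb : ∀ k, ∏ j ∈ Finset.range k, b j ≤ B)
    (hb1 : ∀ k, 1 ≤ b k) :
    ∀ᵐ ω ∂μ, ∃ c : ENNReal, c ≠ ⊤ ∧ ∀ k, V (x k ω) ≤ c := by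
  let 𝓕 : ℕ → MeasurableSpace Ω := fun k =>
    ⨆ j ∈ Iio k, MeasurableSpace.comap (S j) inferInstance
  have h𝓕le : ∀ k, 𝓕 k ≤ ‹MeasurableSpace Ω› := fun k =>
    iSup₂_le fun j _ => (hS j).comap_le
  have h𝓕mono : ∀ k, 𝓕 k ≤ 𝓕 (k + 1) := fun k =>
    biSup_mono fun j (hj : j < k) => show j < k + 1 by omega
  have hSk : ∀ k, Measurable[𝓕 (k + 1)] (S k) := fun k =>
    Measurable.mono (comap_measurable (S k))
      (le_biSup (fun j => MeasurableSpace.comap (S j) inferInstance)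
        (show k ∈ Iio (k + 1) from Nat.lt_succ_self k)) le_rfl
  have hxm : ∀ k, Measurable[𝓕 k] (x k) := by
    intro k
    induction k with
    | zero =>
      have : x 0 = fun _ => x₁ := funext hx₁
      rw [this]
      exact measurable_const
    | succ k ih =>
      have : x (k + 1) = fun ω => T k (x k ω, S k ω) := funext (hx k)
      rw [this]
      exact (hT k).comp ((ih.mono (h𝓕mono k) le_rfl).prodMk (hSk k))
  -- one step, on an event of the past
  have hone : ∀ k (A : Set Ω), MeasurableSet[𝓕 k] A →
      ∫⁻ ω in A, V (x (k + 1) ω) ∂μ ≤ b k * ∫⁻ ω in A, V (x k ω) ∂μ := by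
    intro k A hA
    have hA' := h𝓕le k A hA
    have hi : Measurable[𝓕 k] (A.indicator (1 : Ω → ENNReal)) := by
      have h1 : Measurable[𝓕 k] (1 : Ω → ENNReal) := measurable_const
      exact h1.indicator hA
    -- Carrying the indicator of `A` as a coordinate reduces conditioning on the past to Tonelli for
    -- a product law.
    have hY : Measurable[𝓕 k] fun ω => (A.indicator (1 : Ω → ENNReal) ω, x k ω) :=
      hi.prodMk (hxm k)
    have hYm := hY.mono (h𝓕le k) le_rfl
    have hlaw := (indepFun_iff_map_prod_eq_prod_map_map hYm.aemeasurable
      (hS k).aemeasurable).1 (indepFun_past_next hS hind hY)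
    rw [hSlaw] at hlaw
    set ν := μ.map fun ω => (A.indicator (1 : Ω → ENNReal) ω, x k ω) with hν
    have : IsProbabilityMeasure ν := Measure.isProbabilityMeasure_map hYm.aemeasurable
    have hm : Measurable fun p : (ENNReal × E) × 𝓢 => p.1.1 * V (T k (p.1.2, p.2)) :=
      (measurable_fst.comp measurable_fst).mul
        (hV.comp ((hT k).comp ((measurable_snd.comp measurable_fst).prodMk measurable_snd)))
    have hm2 : Measurable fun p : ENNReal × E => p.1 * V p.2 :=
      measurable_fst.mul (hV.comp measurable_snd)
    have hset : ∀ g : Ω → ENNReal, ∫⁻ ω in A, g ω ∂μ =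
        ∫⁻ ω, A.indicator (1 : Ω → ENNReal) ω * g ω ∂μ := by
      intro g
      rw [← lintegral_indicator hA']
      refine lintegral_congr fun ω => ?_
      by_cases hω : ω ∈ A <;> simp [hω]
    calc ∫⁻ ω in A, V (x (k + 1) ω) ∂μ
        = ∫⁻ p, p.1.1 * V (T k (p.1.2, p.2)) ∂(ν.prod P) := by
          rw [hset, ← hlaw, lintegral_map hm (hYm.prodMk (hS k))]
          simp [hx]
      _ = ∫⁻ p, p.1 * ∫⁻ s, V (T k (p.2, s)) ∂P ∂ν := by
          rw [lintegral_prod _ hm.aemeasurable]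
          refine lintegral_congr fun p => ?_
          exact lintegral_const_mul p.1 (f := fun s => V (T k (p.2, s)))
            (hV.comp ((hT k).comp measurable_prodMk_left))
      _ ≤ ∫⁻ p, b k * (p.1 * V p.2) ∂ν := by
          refine lintegral_mono fun p => ?_
          rw [mul_left_comm]
          gcongr
          exact hstep k p.2
      _ = b k * ∫⁻ ω in A, V (x k ω) ∂μ := by
          rw [lintegral_const_mul _ hm2, hset, lintegral_map hm2 hYm]
  let A : ENNReal → ℕ → Set Ω := fun c k => {ω | ∀ j ≤ k, V (x j ω) ≤ c}
  have hAm : ∀ c k, MeasurableSet[𝓕 k] (A c k) := by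
    intro c k
    have : A c k = ⋂ j ∈ Iic k, {ω | V (x j ω) ≤ c} := by
      ext ω
      simp [A]
    rw [this]
    have hmono : Monotone 𝓕 := monotone_nat_of_le_succ h𝓕mono
    exact MeasurableSet.biInter (to_countable _) fun j hj =>
      hmono hj _ (measurableSet_le (hV.comp (hxm j)) measurable_const)
  have hVx : ∀ k, Measurable fun ω => V (x k ω) := fun k =>
    hV.comp ((hxm k).mono (h𝓕le k) le_rfl)
  -- the process frozen at the first crossing of `c`
  have hville : ∀ c k, c * μ (A c k)ᶜ + ∫⁻ ω in A c k, V (x k ω) ∂μ ≤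
      (∏ j ∈ Finset.range k, b j) * V x₁ := by
    intro c k
    induction k with
    | zero =>
      simp only [Finset.range_zero, Finset.prod_empty, one_mul, hx₁]
      by_cases hc : V x₁ ≤ c
      · have : A c 0 = univ := by
          ext ω
          simp [A, hx₁, hc]
        simp [this]
      · have : A c 0 = ∅ := by
          ext ω
          simp [A, hx₁, hc]
        simpa [this] using (not_le.1 hc).le
    | succ k ih =>
      have hsub : A c (k + 1) ⊆ A c k := fun ω hω j hj => hω j (by omega)
      have hmk := h𝓕le _ _ (hAm c k)
      have hmk1 := h𝓕le _ _ (hAm c (k + 1))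
      have hcompl : (A c (k + 1))ᶜ = (A c k)ᶜ ∪ (A c k \ A c (k + 1)) := by
        ext ω
        have := @hsub ω
        simp only [mem_compl_iff, mem_union, Set.mem_sdiff]
        tauto
      have hbig : ∀ ω ∈ A c k \ A c (k + 1), c ≤ V (x (k + 1) ω) := by
        rintro ω ⟨h1, h2⟩
        by_contra hlt
        refine h2 fun j hj => ?_
        rcases Nat.lt_or_ge j (k + 1) with h | h
        · exact h1 j (by omega)
        · obtain rfl : j = k + 1 := by omega
          exact (not_le.1 hlt).le
      have hmarkov : c * μ (A c k \ A c (k + 1)) ≤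
          ∫⁻ ω in A c k \ A c (k + 1), V (x (k + 1) ω) ∂μ := by
        rw [← setLIntegral_const]
        exact setLIntegral_mono (hVx _) hbig
      have hsplit : ∫⁻ ω in A c (k + 1), V (x (k + 1) ω) ∂μ +
          ∫⁻ ω in A c k \ A c (k + 1), V (x (k + 1) ω) ∂μ =
          ∫⁻ ω in A c k, V (x (k + 1) ω) ∂μ := by
        rw [← lintegral_union (hmk.diff hmk1) disjoint_sdiff_right, union_sdiff_cancel hsub]
      calc c * μ (A c (k + 1))ᶜ + ∫⁻ ω in A c (k + 1), V (x (k + 1) ω) ∂μ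
          ≤ c * μ (A c k)ᶜ + (c * μ (A c k \ A c (k + 1)) +
              ∫⁻ ω in A c (k + 1), V (x (k + 1) ω) ∂μ) := by
            rw [hcompl, ← add_assoc, ← mul_add]
            gcongr
            exact measure_union_le _ _
        _ ≤ c * μ (A c k)ᶜ + ∫⁻ ω in A c k, V (x (k + 1) ω) ∂μ := by
            rw [← hsplit, add_comm (∫⁻ ω in A c (k + 1), V (x (k + 1) ω) ∂μ)]
            gcongr
        -- The stopped mass does not grow; `1 ≤ b k` allows it to carry the same factor.
        _ ≤ b k * (c * μ (A c k)ᶜ) + b k * ∫⁻ ω in A c k, V (x k ω) ∂μ :=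
            add_le_add (le_mul_of_one_le_left' (hb1 k)) (hone k _ (hAm c k))
        _ ≤ b k * ((∏ j ∈ Finset.range k, b j) * V x₁) := by
            rw [← mul_add]
            gcongr
        _ = _ := by
            rw [Finset.prod_range_succ]
            ring
  have hmax : ∀ c, c * μ (⋃ k, (A c k)ᶜ) ≤ B * V x₁ := by
    intro c
    have hmono : Monotone fun k => (A c k)ᶜ := by
      intro i j hij
      exact compl_subset_compl.2 fun ω hω l hl => hω l (hl.trans hij)
    rw [hmono.measure_iUnion, ENNReal.mul_iSup]
    refine iSup_le fun k => ?_
    calc c * μ (A c k)ᶜ ≤ (∏ j ∈ Finset.range k, b j) * V x₁ := le_self_add.trans (hville c k)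
      _ ≤ B * V x₁ := by
        gcongr
        exact hb k
  have hnull : μ {ω | ¬ ∃ c : ENNReal, c ≠ ⊤ ∧ ∀ k, V (x k ω) ≤ c} = 0 := by
    set N := {ω | ¬ ∃ c : ENNReal, c ≠ ⊤ ∧ ∀ k, V (x k ω) ≤ c} with hN
    have hsubN : ∀ m : ℕ, N ⊆ ⋃ k, (A m k)ᶜ := by
      intro m ω hω
      by_contra hcon
      simp only [mem_iUnion, mem_compl_iff, not_exists, not_not] at hcon
      exact hω ⟨m, ENNReal.natCast_ne_top m, fun k => hcon k k le_rfl⟩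
    have hbound : ∀ m : ℕ, (m : ENNReal) * μ N ≤ B * V x₁ := fun m =>
      (mul_le_mul_right (measure_mono (hsubN m)) _).trans (hmax m)
    by_contra hne
    obtain ⟨m, hm⟩ := ENNReal.exists_nat_mul_gt hne (ENNReal.mul_ne_top hB hV₁)
    exact absurd (hbound m) (not_le.2 hm)
  exact hnull

end MarkovRecursion

/-- A bounded gap bounds `F` at the proximal point, which is then bounded by coercivity, and it also
bounds the distance from `x` to that point. -/
theorem norm_bddAbove_of_moreauGap_bdd {n : ℕ} {X : Set (EuclideanSpace ℝ (Fin n))}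
    {F : EuclideanSpace ℝ (Fin n) → ℝ} {c : ℝ} (hc : 0 < c) (hF : BddBelow (F '' X))
    (hcoercive : IsCoerciveOn X F)
    (hprox : ∀ x, ∃ z ∈ X, ∀ y ∈ X, F z + c / 2 * ‖z - x‖ ^ 2 ≤ F y + c / 2 * ‖y - x‖ ^ 2)
    (M : ℝ) : ∃ R : ℝ, ∀ x, moreauGap X F c x ≤ M → ‖x‖ ≤ R := by
  have h1 : ∀ᶠ y in Bornology.cobounded (EuclideanSpace ℝ (Fin n)) ⊓ 𝓟 X,
      M + (⨅ y : X, F y) < F y := hcoercive.eventually_gt_atTop _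
  rw [eventually_inf_principal] at h1
  have h2 : Bornology.IsBounded {y | y ∈ X → M + (⨅ y : X, F y) < F y}ᶜ :=
    Bornology.isBounded_def.2 (by rwa [compl_compl])
  obtain ⟨r, hr⟩ := h2.exists_norm_le
  refine ⟨r + (1 + 2 / c * M), fun x hx => ?_⟩
  obtain ⟨z, hzX, hz⟩ := hprox x
  rw [moreauGap_eq hF hc.le hzX hz] at hx
  have h3 : 0 ≤ c / 2 * ‖z - x‖ ^ 2 := by positivity
  have hzr : ‖z‖ ≤ r := hr z fun hlt => by linarith [hlt hzX]
  have h4 : c / 2 * ‖z - x‖ ^ 2 ≤ M := by linarith [ciInf_le_of_mem hF hzX]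
  have h5 : ‖z - x‖ ^ 2 ≤ 2 / c * M := by
    have := mul_le_mul_of_nonneg_left h4 (by positivity : 0 ≤ 2 / c)
    have e : 2 / c * (c / 2 * ‖z - x‖ ^ 2) = ‖z - x‖ ^ 2 := by field_simp
    rwa [e] at this
  have h6 : ‖z - x‖ ≤ 1 + 2 / c * M := by nlinarith [sq_nonneg (‖z - x‖ - 1)]
  have h7 : ‖x‖ ≤ ‖z‖ + ‖z - x‖ := by
    have := norm_sub_le z (z - x)
    rwa [sub_sub_cancel] at this
  linarith

theorem mainTheorem5 {n : ℕ} {𝓢 Ω : Type*} [MeasurableSpace 𝓢] [MeasurableSpace Ω]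
    (P : Measure 𝓢) [IsProbabilityMeasure P] (μ : Measure Ω) [IsProbabilityMeasure μ]
    (X : Set (EuclideanSpace ℝ (Fin n))) (hXclosed : IsClosed X) (hXconvex : Convex ℝ X)
    (f : EuclideanSpace ℝ (Fin n) → 𝓢 → ℝ) (ρ : 𝓢 → ℝ)
    (hfmeas : ∀ x, Measurable (f x))
    (hfint : ∀ x ∈ X, Integrable (f x) P)
    (hρmeas : Measurable ρ) (hρ : MemLp ρ 2 P)
    (hweak : ∀ s, IsWeaklyConvex (ρ s) (fun x => f x s))
    (hnoise : BoundedNoiseAtOptimum X f P)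
    (hvar : RelativeVarianceBound X f P)
    (hbelow : BddBelow (populationLoss f P '' X))
    (hcoercive : IsCoerciveOn X (populationLoss f P))
    (S : ℕ → Ω → 𝓢) (hSmeas : ∀ k, Measurable (S k)) (hSlaw : ∀ k, μ.map (S k) = P)
    (hSindep : iIndepFun S μ)
    (α : ℕ → ℝ) (hαpos : ∀ k, 0 < α k) (hαsq : Summable (fun k => α k ^ 2))
    (x₁ : EuclideanSpace ℝ (Fin n)) (x : ℕ → Ω → EuclideanSpace ℝ (Fin n))
    (hx₁ : ∀ ω, x 0 ω = x₁)
    (hx : ∀ k ω, IsModelUpdate X (proxModel f ρ) (α k) (S k ω) (x k ω) (x (k + 1) ω)) :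
    ∀ᵐ ω ∂μ, BddAbove (range fun k =>
      Metric.infDist (x k ω) (optimalSet X (populationLoss f P))) := by
  have h : StochasticWeaklyConvexProblem X f ρ P :=
    ⟨hXclosed, hXconvex, hfmeas, hfint, hρmeas, hρ, hweak, hnoise.1, hvar⟩
  obtain ⟨xs, hxs⟩ := hnoise.1
  obtain ⟨c, hc₀, hc⟩ : ∃ c : ℝ, 0 < c ∧ ∫ s, ρ s ∂P ≤ c :=
    ⟨|∫ s, ρ s ∂P| + 1, by positivity, by linarith [le_abs_self (∫ s, ρ s ∂P)]⟩
  obtain ⟨C, hC, hstep⟩ := h.exists_lintegral_moreauGap_step_le hbelow hc₀ hc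
  choose T hT using fun k (p : EuclideanSpace ℝ (Fin n) × 𝓢) =>
    exists_isModelUpdate hXclosed ⟨xs, hxs.1⟩ hfmeas hρmeas hweak (hαpos k) p.1 p.2
  have hTm : ∀ k, Measurable (T k) := fun k =>
    measurable_of_isModelUpdate hXconvex hfmeas hρmeas hweak (hαpos k) (hT k)
  -- Uniqueness of the update identifies the given iterates, not assumed measurable, with the
  -- recursion driven by the measurable map `T k`.
  have hxT : ∀ k ω, x (k + 1) ω = T k (x k ω, S k ω) := fun k ω =>
    (hx k ω).unique hXconvex hweak (hαpos k) (hT k (x k ω, S k ω))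
  -- Square summability of the stepsizes enters here, through `1 + t ≤ exp t`.
  have hprod : ∀ k, ∏ j ∈ Finset.range k, ENNReal.ofReal (1 + C * α j ^ 2) ≤
      ENNReal.ofReal (Real.exp (∑' j, C * α j ^ 2)) := by
    intro k
    rw [← ENNReal.ofReal_prod_of_nonneg fun j _ => by positivity]
    refine ENNReal.ofReal_le_ofReal ?_
    calc ∏ j ∈ Finset.range k, (1 + C * α j ^ 2)
        ≤ ∏ j ∈ Finset.range k, Real.exp (C * α j ^ 2) :=
          Finset.prod_le_prod (fun j _ => by positivity) fun j _ => by
            linarith [Real.add_one_le_exp (C * α j ^ 2)]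
      _ = Real.exp (∑ j ∈ Finset.range k, C * α j ^ 2) := (Real.exp_sum _ _).symm
      _ ≤ _ := Real.exp_le_exp.2
          ((hαsq.mul_left C).sum_le_tsum _ fun j _ => by positivity)
  have hmain := ae_bddAbove_of_lintegral_step_le hSmeas hSlaw hSindep hx₁ hTm hxT
    (V := fun y => ENNReal.ofReal (moreauGap X (populationLoss f P) c y + 1))
    ((measurable_moreauGap hbelow hc₀.le).add_const 1).ennreal_ofReal ENNReal.ofReal_ne_top
    (fun k y => hstep (α k) (hαpos k) y (fun s => T k (y, s))
      ((hTm k).comp measurable_prodMk_left) fun s => hT k (y, s))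
    ENNReal.ofReal_ne_top hprod
    (fun k => ENNReal.one_le_ofReal.2 (by
      have : 0 ≤ C * α k ^ 2 := by positivity
      linarith))
  filter_upwards [hmain] with ω ⟨M, hM, hle⟩
  obtain ⟨R, hR⟩ := norm_bddAbove_of_moreauGap_bdd hc₀ hbelow hcoercive
    (h.exists_proximal_point hc₀) M.toReal
  refine ⟨R + ‖xs‖, forall_mem_range.2 fun k => ?_⟩
  have h1 : moreauGap X (populationLoss f P) c (x k ω) ≤ M.toReal := by
    have := (ENNReal.ofReal_le_iff_le_toReal hM).1 (hle k)
    linarith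
  calc Metric.infDist (x k ω) (optimalSet X (populationLoss f P))
      ≤ dist (x k ω) xs := Metric.infDist_le_dist_of_mem hxs
    _ ≤ ‖x k ω‖ + ‖xs‖ := by
      rw [dist_eq_norm]
      exact norm_sub_le _ _
    _ ≤ R + ‖xs‖ := by linarith [hR _ h1]
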